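/- Let $n\ge 1$ and let $\mathcal M_\theta\subset\mathbb R^n$ (for fixed control parameters $\theta$) be a nonempty connected open set, the set of values of the continuous stochastic variables $I=(I^1,\dots,I^n)$, equipped with a Riemannian metric $g_{ij}(I|\theta)$ and a function $\mathcal S(I|\theta)$ (the information potential), both twice continuously differentiable. Write $d\mu=\sqrt{|g_{ij}/2\pi|}\,dI$ (where $|\cdot|$ is the absolute value of the determinant) for the invariant volume element. The length of a $C^1$ curve $\gamma:[a,b]\to\mathcal M_\theta$ is $\int_a^b\sqrt{g_{ij}\dot\gamma^i\dot\gamma^j}\,dt$, the Riemannian distance $\mathfrak D_\theta(P,Q)$ is the infimum of the lengths of the $C^1$ curves in $\mathcal M_\theta$ from $P$ to $Q$, and a geodesic is a curve of minimal length among all curves with the same end points. Assume: 1. $dp(I|\theta)=e^{\mathcal S(I|\theta)}\,d\mu(I|\theta)$ is a probability distribution on $\mathcal M_\theta$; 2. along every geodesic $\gamma:[a,b]\to\mathcal M_\theta$ ($a<b$) of unit speed, the information dissipation $\Phi(t)=\frac{d}{dt}\mathcal S(\gamma(t))$ satisfies $\Delta s=\Phi(t_1)-\Phi(t_2)$ for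 all $a\le t_1<t_2\le b$, where $\Delta s$ is the length of $\gamma$ between $t_1$ and $t_2$; 3. the probability weight $\omega=e^{\mathcal S}$ vanishes on the boundary of $\mathcal M_\theta$ (including the boundary at infinity), i.e. for every $\varepsilon>0$ there is a compact $K\subset\mathcal M_\theta$ with $\omega<\varepsilon$ on $\mathcal M_\theta\setminus K$. Let $\psi_i=-\partial\mathcal S/\partial I^i$, let $\psi=\sqrt{g^{ij}\psi_i\psi_j}$ be the norm of the gradient of $\mathcal S$, and let $\mathcal P(\theta)=-\log\int_{\mathcal M_\theta}e^{-\psi^2/2}\,d\mu$ be the gaussian potential. Then $\mathcal S$ has a unique global maximum point $\bar I\in\mathcal M_\theta$, and: (a) every nonempty level set $\{I\in\mathcal M_\theta:\mathcal S(I|\theta)=c\}$ is a geodesic sphere centred at $\bar I$: there is $\ell\ge 0$ such that it equals $\{I\in\mathcal M_\theta:\mathfrak D_\theta(I,\bar I)=\ell\}$, this set is the topological boundary of the geodesic ball $\{I\in\mathcal M_\theta:\mathfrak D_\theta(I,\bar I)\le\ell\}$, and $c=\mathcal P(\theta)-\tfrac12\ell^2$; (b) for every $I\in\mathcal M_\theta$,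 $\psi(I|\theta)=\mathfrak D_\theta(I,\bar I)$ and $$\mathcal S(I|\theta)=\mathcal P(\theta)-\tfrac12\mathfrak D_\theta(I,\bar I)^2=\mathcal P(\theta)-\tfrac12\psi(I|\theta)^2 ,$$ and the distance $\mathfrak D_\theta(I,\bar I)$ is the length of a geodesic from $\bar I$ to $I$. -/

import Mathlib

open MeasureTheory Set Filter Topology

noncomputable section

/-- A statistical manifold `M` of `n` continuous stochastic variables `I = (I¹, …, Iⁿ)`: a nonempty
connected open set of values of `I`, with a Riemannian metric tensor `g i j (I)`. -/
structure StatisticalManifold (n : ℕ) where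
  /-- the admissible values of the stochastic variables -/
  carrier : Set (Fin n → ℝ)
  isOpen_carrier : IsOpen carrier
  isConnected_carrier : IsConnected carrier
  /-- the metric tensor in the coordinates `I` -/
  g : (Fin n → ℝ) → Matrix (Fin n) (Fin n) ℝ
  g_contDiffOn : ∀ i j, ContDiffOn ℝ 2 (fun x => g x i j) carrier
  g_posDef : ∀ x ∈ carrier, (g x).PosDef

namespace StatisticalManifold

variable {n : ℕ} (X : StatisticalManifold n)

/-- `g_{ij}(x) vⁱ vʲ`. -/
def normSq (x v : Fin n → ℝ) : ℝ := dotProduct v (Matrix.mulVec (X.g x) v)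

/-- `√|g_{ij}(x) / 2π|`, where `|·|` is the absolute value of the determinant. -/
def volumeFactor (x : Fin n → ℝ) : ℝ :=
  Real.sqrt |Matrix.det ((2 * Real.pi)⁻¹ • X.g x)|

/-- The invariant volume element `dμ = √|g_{ij} / 2π| dI` on the manifold. -/
def invVolume : Measure (Fin n → ℝ) :=
  (volume.restrict X.carrier).withDensity fun x => ENNReal.ofReal (X.volumeFactor x)

/-- `γ`, restricted to `[a, b]`, is a continuously differentiable curve in the manifold. -/
structure IsCurve (γ : ℝ → Fin n → ℝ) (a b : ℝ) : Prop where
  le : a ≤ b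
  contDiffOn : ContDiffOn ℝ 1 γ (Icc a b)
  mapsTo : MapsTo γ (Icc a b) X.carrier

/-- The length of the part of a curve with parameter in `[a, b]`. -/
def length (γ : ℝ → Fin n → ℝ) (a b : ℝ) : ℝ :=
  ∫ t in a..b, Real.sqrt (X.normSq (γ t) (derivWithin γ (Icc a b) t))

/-- A geodesic: a curve of minimal length among all curves with the same end points. -/
structure IsGeodesic (γ : ℝ → Fin n → ℝ) (a b : ℝ) : Prop where
  isCurve : X.IsCurve γ a b
  minimal : ∀ (η : ℝ → Fin n → ℝ) (c d : ℝ), X.IsCurve η c d → η c = γ a → η d = γ b →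
    X.length γ a b ≤ X.length η c d

/-- Unitary affine parametrization of a curve on `[a, b]`. -/
def IsUnitSpeed (γ : ℝ → Fin n → ℝ) (a b : ℝ) : Prop :=
  ∀ t ∈ Icc a b, X.normSq (γ t) (derivWithin γ (Icc a b) t) = 1

/-- The Riemannian distance: the infimum of the lengths of the curves from `p` to `q`. -/
def dist (p q : Fin n → ℝ) : ℝ :=
  sInf {l | ∃ (γ : ℝ → Fin n → ℝ) (a b : ℝ), X.IsCurve γ a b ∧ γ a = p ∧ γ b = q ∧
    X.length γ a b = l}

/-- The geodesic ball of radius `r` around `p`, with its boundary points. -/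
def geodesicBall (p : Fin n → ℝ) (r : ℝ) : Set (Fin n → ℝ) := {x ∈ X.carrier | X.dist x p ≤ r}

/-- The geodesic sphere of radius `r` around `p`. -/
def geodesicSphere (p : Fin n → ℝ) (r : ℝ) : Set (Fin n → ℝ) := {x ∈ X.carrier | X.dist x p = r}

end StatisticalManifold

/-- A fluctuation geometry (for fixed control parameters): a statistical manifold with an
information potential `S` that are tied together by the postulates of the theory. -/
structure FluctuationGeometry (n : ℕ) extends StatisticalManifold n where
  /-- the information potential -/
  S : (Fin n → ℝ) → ℝ
  S_contDiffOn : ContDiffOn ℝ 2 S carrier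
  /-- `dp = exp(S) dμ` is a probability distribution. -/
  isProbabilityMeasure :
    IsProbabilityMeasure (toStatisticalManifold.invVolume.withDensity
      fun x => ENNReal.ofReal (Real.exp (S x)))
  /-- Along a geodesic `γ` with unitary affine parametrization, the length of the part between any
  two parameters is the drop of the information dissipation `Φ(t) = d S(γ(t)) / dt`. -/
  length_eq_dissipation_drop : ∀ (γ : ℝ → Fin n → ℝ) (a b : ℝ), a < b →
    toStatisticalManifold.IsGeodesic γ a b → toStatisticalManifold.IsUnitSpeed γ a b →
    ∀ t₁ ∈ Icc a b, ∀ t₂ ∈ Icc a b, t₁ < t₂ →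
      toStatisticalManifold.length γ t₁ t₂ =
        derivWithin (S ∘ γ) (Icc a b) t₁ - derivWithin (S ∘ γ) (Icc a b) t₂
  /-- The probability weight `ω = exp(S)` vanishes on the boundary of the manifold, that is, when
  `I` leaves every compact subset of the manifold (the boundary may lie at infinity; there is
  no condition when the manifold is compact). This is the coordinate-free form of the vanishing of
  the density `ρ = ω √|g_{ij} / 2π|` on the boundary, where `|g_{ij}|` is not allowed to degenerate;
  see `StatisticalManifold.tendsto_weight` below. -/
  weight_tendsto : Tendsto (fun x : carrier => Real.exp (S x)) (cocompact carrier) (𝓝 0)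

/-- If the probability density `ρ = exp(S) √|g_{ij} / 2π|` vanishes on the boundary and the
determinant of the metric tensor does not degenerate there, the probability weight `exp(S)`
vanishes on the boundary. -/
theorem StatisticalManifold.tendsto_weight {n : ℕ} (X : StatisticalManifold n)
    (S : (Fin n → ℝ) → ℝ) (c : ℝ) (hc : 0 < c) (hdet : ∀ x ∈ X.carrier, c ≤ (X.g x).det)
    (hρ : Tendsto (fun x : X.carrier => Real.exp (S x) * X.volumeFactor x)
      (cocompact X.carrier) (𝓝 0)) :
    Tendsto (fun x : X.carrier => Real.exp (S x)) (cocompact X.carrier) (𝓝 0) := by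
  set k : ℝ := Real.sqrt ((2 * Real.pi)⁻¹ ^ n * c) with hk
  have hpi : 0 < (2 * Real.pi)⁻¹ ^ n := by positivity
  have hk0 : 0 < k := Real.sqrt_pos.2 (mul_pos hpi hc)
  have hlim := hρ.mul_const k⁻¹
  rw [zero_mul] at hlim
  refine squeeze_zero (fun x => (Real.exp_pos _).le) (fun x => ?_) hlim
  have hle : k ≤ X.volumeFactor x := by
    refine Real.sqrt_le_sqrt (le_trans ?_ (le_abs_self _))
    rw [Matrix.det_smul, Fintype.card_fin]
    exact mul_le_mul_of_nonneg_left (hdet x x.2) hpi.le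
  rw [mul_assoc]
  refine le_mul_of_one_le_right (Real.exp_pos _).le ?_
  rw [← div_eq_mul_inv, one_le_div hk0]
  exact hle

namespace FluctuationGeometry

variable {n : ℕ} (F : FluctuationGeometry n)

/-- Covariant components `ψ_i = -∂S/∂Iⁱ` of the gradiental vector. -/
def gradCov (x : Fin n → ℝ) : Fin n → ℝ := fun i => -(fderiv ℝ F.S x (Pi.single i 1))

/-- Contravariant components `ψⁱ = g^{ij} ψ_j` of the gradiental vector. -/
def gradContra (x : Fin n → ℝ) : Fin n → ℝ := Matrix.mulVec (F.g x)⁻¹ (F.gradCov x)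

/-- The norm `ψ` of the gradiental vector, `ψ² = ψⁱ ψ_i`. -/
def gradNorm (x : Fin n → ℝ) : ℝ := Real.sqrt (dotProduct (F.gradContra x) (F.gradCov x))

/-- The gaussian partition function `𝒵 = ∫ exp(-ψ²/2) dμ`. -/
def partitionFunction : ℝ := ∫ x, Real.exp (-(F.gradNorm x ^ 2) / 2) ∂F.invVolume

/-- The gaussian potential `𝒫 = -log 𝒵`. -/
def gaussianPotential : ℝ := -Real.log F.partitionFunction

/-- The hyper-surface of the manifold on which the information potential has the value `c`. -/
def levelSet (c : ℝ) : Set (Fin n → ℝ) := {x ∈ F.carrier | F.S x = c}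

end FluctuationGeometry

end

/-! The dissipation postulate says that (S ∘ γ)'' = -1 along unit speed minimal geodesics. Short
ones leave every point in every direction, so it amounts to Hess S = -g for the covariant Hessian
(`geodesicHessian_eq`). Contracting with the gradient gives d(ψ²) = -2 dS, so S + ψ²/2 is a constant
m on the connected manifold (`exists_S_add_gradNorm_sq`). The normalisation of exp(S) identifies m
with the gaussian potential (`gaussianPotential_eq`).

It remains to see that ψ is the distance to the maximum point p. Away from critical points ψ = √(2(m
- S)) has a differential of norm 1, so ψ changes along a curve by at most its length
(`abs_gradNorm_sub_le_length`); this gives ψ ≤ distance. Conversely, along the unit speed geodesic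
that leaves x in the gradient direction, S = S(x) + ψ(x) t - t²/2. It therefore stays in the compact
set {S ≥ S(x)} and reaches the level m at time ψ(x) (`exists_geodesic_to_max`). The point reached is
critical, and it is p: critical points are isolated, and a path between two of them could be pushed
up to the level m by gradient steps, although it must cross a small sphere around one of them on
which S < m (`critical_point_unique`).

Since the postulate concerns curves of minimal length, short solutions of the geodesic equation must
be shown to be minimal. This is done by calibration with a function, quadratic in x, that satisfies
a Hamilton–Jacobi inequality (`le_length_of_mem_ball`). Geodesics are treated throughout as a
Hamiltonian flow on covectors. -/

set_option maxSynthPendingDepth 3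

/-! ### Geodesic flow in Hamiltonian form -/

section HamiltonField

variable {E : Type*} [NormedAddCommGroup E] [NormedSpace ℝ E]

/-- The force `-½ ∂ₓ (p · G(x) p)` of the geodesic Hamiltonian with cometric `G`. -/
noncomputable def geodesicForce (G : E → (E →L[ℝ] ℝ) →L[ℝ] E) (x : E) (p : E →L[ℝ] ℝ) :
    E →L[ℝ] ℝ :=
  (-(1 / 2) : ℝ) • p.comp ((fderiv ℝ G x).flip p)

theorem geodesicForce_apply (G : E → (E →L[ℝ] ℝ) →L[ℝ] E) (x : E) (p : E →L[ℝ] ℝ) (h : E) :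
    geodesicForce G x p h = -(1 / 2) * p (fderiv ℝ G x h p) := by
  simp [geodesicForce]

/-- The Hamiltonian vector field of `½ p · G(x) p`. -/
noncomputable def hamiltonField (G : E → (E →L[ℝ] ℝ) →L[ℝ] E) (z : E × (E →L[ℝ] ℝ)) :
    E × (E →L[ℝ] ℝ) :=
  (G z.1 z.2, geodesicForce G z.1 z.2)

/-- The force contains one derivative of G, so a C² cometric gives a C¹ field, which is enough for
Picard–Lindelöf. -/
theorem contDiffOn_hamiltonField {G : E → (E →L[ℝ] ℝ) →L[ℝ] E} {U : Set E} (hU : IsOpen U)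
    (hG : ContDiffOn ℝ 2 G U) : ContDiffOn ℝ 1 (hamiltonField G) (U ×ˢ univ) := by
  have h1 : ContDiffOn ℝ 1 (fun z : E × (E →L[ℝ] ℝ) => G z.1) (U ×ˢ univ) :=
    (hG.of_le one_le_two).comp contDiffOn_fst fun z hz => hz.1
  have h2 : ContDiffOn ℝ 1 (fun z : E × (E →L[ℝ] ℝ) => fderiv ℝ G z.1) (U ×ˢ univ) :=
    (hG.fderiv_of_isOpen hU (m := 1) (by norm_num)).comp contDiffOn_fst fun z hz => hz.1
  have h3 : ContDiffOn ℝ 1 (fun z : E × (E →L[ℝ] ℝ) => (fderiv ℝ G z.1).flip) (U ×ˢ univ) :=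
    (ContinuousLinearMap.flipₗᵢ ℝ E (E →L[ℝ] ℝ) E).contDiff.comp_contDiffOn h2
  refine (h1.clm_apply contDiffOn_snd).prodMk ?_
  exact (contDiffOn_snd.clm_comp (h3.clm_apply contDiffOn_snd)).const_smul _

variable {G : E → (E →L[ℝ] ℝ) →L[ℝ] E} {z : ℝ → E × (E →L[ℝ] ℝ)} {s : Set ℝ} {t : ℝ}

/-- By symmetry of G the force enters twice, each time with the factor -1/2, and cancels the
derivative of G. -/
theorem hasDerivWithinAt_hamilton_energy
    (hG : DifferentiableAt ℝ G (z t).1) (hsymm : ∀ p q : E →L[ℝ] ℝ, p (G (z t).1 q) = q (G (z t).1 p))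
    (hz : HasDerivWithinAt z (hamiltonField G (z t)) s t) :
    HasDerivWithinAt (fun r => (z r).2 (G (z r).1 (z r).2)) 0 s t := by
  have h1 : HasDerivWithinAt (fun r => (z r).1) (G (z t).1 (z t).2) s t :=
    ((hasFDerivAt_fst (𝕜 := ℝ) (p := z t)).comp_hasDerivWithinAt t hz)
  have h2 : HasDerivWithinAt (fun r => (z r).2) (geodesicForce G (z t).1 (z t).2) s t :=
    ((hasFDerivAt_snd (𝕜 := ℝ) (p := z t)).comp_hasDerivWithinAt t hz)
  have h3 := HasFDerivAt.comp_hasDerivWithinAt (f := fun r => (z r).1) t hG.hasFDerivAt h1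
  have h4 := h2.clm_apply (h3.clm_apply h2)
  refine h4.congr_deriv ?_
  simp only [Function.comp, map_add, geodesicForce_apply, hsymm (z t).2 (geodesicForce _ _ _)]
  ring

/-- The second derivative of `S` along the geodesic with initial covector `p`. -/
noncomputable def geodesicHessian (G : E → (E →L[ℝ] ℝ) →L[ℝ] E) (S : E → ℝ) (x : E)
    (p : E →L[ℝ] ℝ) : ℝ :=
  fderiv ℝ (fderiv ℝ S) x (G x p) (G x p) + fderiv ℝ S x (fderiv ℝ G x (G x p) p) -
    (1 / 2) * p (fderiv ℝ G x (G x (fderiv ℝ S x)) p)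

/-- The last term of `geodesicHessian` is the force: symmetry turns ∂S · G(force) into the force
paired with G ∂S. -/
theorem hasDerivWithinAt_fderiv_hamilton {S : E → ℝ}
    (hG : DifferentiableAt ℝ G (z t).1) (hsymm : ∀ p q : E →L[ℝ] ℝ, p (G (z t).1 q) = q (G (z t).1 p))
    (hS : DifferentiableAt ℝ (fderiv ℝ S) (z t).1)
    (hz : HasDerivWithinAt z (hamiltonField G (z t)) s t) :
    HasDerivWithinAt (fun r => fderiv ℝ S (z r).1 (G (z r).1 (z r).2))
      (geodesicHessian G S (z t).1 (z t).2) s t := by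
  have h1 : HasDerivWithinAt (fun r => (z r).1) (G (z t).1 (z t).2) s t :=
    ((hasFDerivAt_fst (𝕜 := ℝ) (p := z t)).comp_hasDerivWithinAt t hz)
  have h2 : HasDerivWithinAt (fun r => (z r).2) (geodesicForce G (z t).1 (z t).2) s t :=
    ((hasFDerivAt_snd (𝕜 := ℝ) (p := z t)).comp_hasDerivWithinAt t hz)
  have h3 := HasFDerivAt.comp_hasDerivWithinAt (f := fun r => (z r).1) t hG.hasFDerivAt h1
  have h4 := (HasFDerivAt.comp_hasDerivWithinAt (f := fun r => (z r).1) t hS.hasFDerivAt h1).clm_apply (h3.clm_apply h2)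
  refine h4.congr_deriv ?_
  simp only [Function.comp, map_add, geodesicForce_apply, hsymm _ (geodesicForce _ _ _),
    geodesicHessian]
  ring

/-- A function whose geodesic second derivatives are `-p · G p` has
`∂ (∂S · G ∂S) = -2 ∂S`. -/
theorem fderiv_gradient_sq_of_geodesicHessian {S : E → ℝ} {U : Set E} (hU : IsOpen U)
    (hG : ContDiffOn ℝ 2 G U) (hS : ContDiffOn ℝ 2 S U)
    (hsymm : ∀ x ∈ U, ∀ p q : E →L[ℝ] ℝ, p (G x q) = q (G x p))
    {x : E} (hx : x ∈ U) (hQ : ∀ p, geodesicHessian G S x p = -p (G x p)) (q : E →L[ℝ] ℝ) :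
    HasFDerivAt (fun y => fderiv ℝ S y (G y (fderiv ℝ S y)))
      (fderiv ℝ (fun y => fderiv ℝ S y (G y (fderiv ℝ S y))) x) x ∧
    fderiv ℝ (fun y => fderiv ℝ S y (G y (fderiv ℝ S y))) x (G x q) =
      -2 * fderiv ℝ S x (G x q) := by
  have hGd : DifferentiableAt ℝ G x :=
    (hG.contDiffAt (hU.mem_nhds hx)).differentiableAt two_ne_zero
  have hS2 : DifferentiableAt ℝ (fderiv ℝ S) x :=
    ((hS.fderiv_of_isOpen hU (m := 1) (by norm_num)).contDiffAt
      (hU.mem_nhds hx)).differentiableAt one_ne_zero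
  have hsnd : IsSymmSndFDerivAt ℝ S x :=
    (hS.contDiffAt (hU.mem_nhds hx)).isSymmSndFDerivAt (by simp)
  -- The symmetry of G holds on an open set, hence passes to its derivative.
  have hDsymm : ∀ (v : E) (p r : E →L[ℝ] ℝ), p (fderiv ℝ G x v r) = r (fderiv ℝ G x v p) := by
    intro v p r
    have e1 : HasFDerivAt (fun y => p (G y r)) _ x :=
      p.hasFDerivAt.comp x (hGd.hasFDerivAt.clm_apply (hasFDerivAt_const r x))
    have e2 : HasFDerivAt (fun y => r (G y p)) _ x :=
      r.hasFDerivAt.comp x (hGd.hasFDerivAt.clm_apply (hasFDerivAt_const p x))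
    have e3 : (fun y => p (G y r)) =ᶠ[𝓝 x] fun y => r (G y p) := by
      filter_upwards [hU.mem_nhds hx] with y hy using hsymm y hy p r
    have := e1.unique (e2.congr_of_eventuallyEq e3)
    simpa using congrArg (fun L : E →L[ℝ] ℝ => L v) this
  have hd := hS2.hasFDerivAt.clm_apply (hGd.hasFDerivAt.clm_apply hS2.hasFDerivAt)
  refine ⟨hd.differentiableAt.hasFDerivAt, ?_⟩
  rw [hd.fderiv]
  set σ := fderiv ℝ S x with hσ
  -- Polarisation of the quadratic identity at (σ, q). The terms with the derivative of G along G σ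
  -- cancel, and what remains is half of the derivative of σ · G σ along G q.
  have h1 := hQ (σ + q)
  have h2 := hQ (σ - q)
  simp only [geodesicHessian, map_add, map_sub, add_apply,
    sub_apply, ← hσ] at h1 h2
  have a1 := hsnd (G x q) (G x σ)
  have a2 := hDsymm (G x σ) σ q
  have a3 := hsymm x hx σ q
  have a4 := hsymm x hx σ (fderiv ℝ (fderiv ℝ S) x (G x q))
  simp only [add_apply, ContinuousLinearMap.comp_apply,
    ContinuousLinearMap.flip_apply, map_add, a4]
  linarith

end HamiltonField

/-! ### Minimality of short geodesics by calibration -/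

section Calibration

variable {E F : Type*} [NormedAddCommGroup E] [NormedSpace ℝ E]
  [NormedAddCommGroup F] [NormedSpace ℝ F]

/-- A locally uniform second order Taylor estimate. -/
theorem ContDiffAt.exists_ball_taylor {f : E → F} {x₀ : E} (hf : ContDiffAt ℝ 2 f x₀)
    {V : Set E} (hV : V ∈ 𝓝 x₀) :
    ∃ ρ > 0, ∃ K ≥ 0, Metric.ball x₀ ρ ⊆ V ∧
      (∀ x ∈ Metric.ball x₀ ρ, ‖f x‖ ≤ K) ∧
      ∀ x ∈ Metric.ball x₀ ρ, ∀ y ∈ Metric.ball x₀ ρ, ‖f y - f x‖ ≤ K * ‖y - x‖ ∧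
        ‖f y - f x - fderiv ℝ f x (y - x)‖ ≤ K * ‖y - x‖ ^ 2 := by
  obtain ⟨K₁, t₁, ht₁, hl₁⟩ := (hf.of_le one_le_two).exists_lipschitzOnWith
  obtain ⟨K₂, t₂, ht₂, hl₂⟩ :=
    (hf.fderiv_right (m := 1) (by norm_num)).exists_lipschitzOnWith
  have hb : ∀ᶠ x in 𝓝 x₀, ‖f x‖ < ‖f x₀‖ + 1 :=
    hf.continuousAt.norm.eventually_lt continuousAt_const (by linarith)
  have hd : ∀ᶠ x in 𝓝 x₀, DifferentiableAt ℝ f x :=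
    (hf.eventually (by simp)).mono fun x hx => hx.differentiableAt two_ne_zero
  obtain ⟨ρ, hρ, hsub⟩ := Metric.mem_nhds_iff.1
    (inter_mem (inter_mem ht₁ ht₂) (inter_mem (inter_mem hb hd) hV))
  have h1 := norm_nonneg (f x₀)
  have h2 := K₁.coe_nonneg
  have h3 := K₂.coe_nonneg
  refine ⟨ρ, hρ, K₁ + K₂ + (‖f x₀‖ + 1), by positivity, fun x hx => (hsub hx).2.2, ?_, ?_⟩
  · intro x hx
    have := (hsub hx).2.1.1
    simp only [mem_ofPred_eq] at this
    linarith
  · intro x hx y hy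
    constructor
    · have := hl₁.norm_sub_le (hsub hy).1.1 (hsub hx).1.1
      refine this.trans (mul_le_mul_of_nonneg_right ?_ (norm_nonneg _))
      linarith
    · have hseg : segment ℝ x y ⊆ Metric.ball x₀ ρ := (convex_ball x₀ ρ).segment_subset hx hy
      -- Mean value inequality for f minus its differential at x, whose derivative is at most K₂ ‖y
      -- - x‖ on the segment.
      have := (convex_segment x y).norm_image_sub_le_of_norm_hasFDerivWithin_le'
        (f := f) (f' := fderiv ℝ f) (φ := fderiv ℝ f x) (C := K₂ * ‖y - x‖)
        (fun w hw => (hsub (hseg hw)).2.1.2.hasFDerivAt.hasFDerivWithinAt)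
        (fun w hw => (hl₂.norm_sub_le (hsub (hseg hw)).1.2 (hsub hx).1.2).trans
          (mul_le_mul_of_nonneg_left (norm_sub_le_of_mem_segment hw) h3))
        (left_mem_segment ℝ x y) (right_mem_segment ℝ x y)
      refine this.trans ?_
      rw [mul_assoc, ← sq]
      refine mul_le_mul_of_nonneg_right ?_ (sq_nonneg _)
      linarith

/-- The Hamilton–Jacobi inequality for a quadratic function along a geodesic. -/
theorem hamiltonJacobi_quadratic_le {G : E → (E →L[ℝ] ℝ) →L[ℝ] E} {Q : E →L[ℝ] E →L[ℝ] ℝ}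
    {u x : E} {p : E →L[ℝ] ℝ} {K M k C t : ℝ} (hK0 : 0 ≤ K) (hk : 0 ≤ k) (hC : 0 ≤ C) (ht : 0 ≤ t)
    (hsymm : ∀ p q : E →L[ℝ] ℝ, p (G x q) = q (G x p))
    (hK : ‖G x‖ ≤ K) (hK1 : ‖G x - G u‖ ≤ K * ‖x - u‖)
    (hK2 : ‖G x - G u - fderiv ℝ G u (x - u)‖ ≤ K * ‖x - u‖ ^ 2)
    (hp : ‖p‖ ≤ M) (hp1 : p (G u p) = 1) (hQ : ‖Q (x - u)‖ ≤ k * ‖x - u‖)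
    (hQpos : ‖x - u‖ ^ 2 ≤ Q (x - u) (x - u))
    (hcond : K * M ^ 2 + 2 * C * t * k * K * M + C ^ 2 * t ^ 2 * k ^ 2 * K ≤ C) :
    (1 / 2 + geodesicForce G u p (x - u) - 1 - C / 2 * Q (x - u) (x - u) +
      C * t * Q (x - u) (G u p)) +
      1 / 2 * (p - (C * t) • Q (x - u)) (G x (p - (C * t) • Q (x - u))) ≤ 0 := by
  -- For φ(t, x) = t/2 + p(x - u) - (C t/2) Q(x - u, x - u), with (u, p) moving along the flow, the
  -- claim is ∂ₜφ + ½ |∂ₓφ|² ≤ 0. The terms of order 0 and 1 in h cancel by `hp1` and the choice of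
  -- the force. The remainders `b1`, `b2`, `b3` are of order ‖h‖² and are absorbed by -(C/2) Q(h, h)
  -- thanks to `hcond`.
  set h := x - u with hh
  have hM : 0 ≤ M := (norm_nonneg _).trans hp
  have ha : 0 ≤ ‖h‖ := norm_nonneg h
  have b1 : p (G x p) - p (G u p) - p (fderiv ℝ G u h p) ≤ K * ‖h‖ ^ 2 * M ^ 2 := by
    have e : p (G x p) - p (G u p) - p (fderiv ℝ G u h p) =
        p ((G x - G u - fderiv ℝ G u h) p) := by simp
    rw [e]
    calc p ((G x - G u - fderiv ℝ G u h) p)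
        ≤ ‖p‖ * (‖G x - G u - fderiv ℝ G u h‖ * ‖p‖) :=
          (le_abs_self _).trans ((p.le_opNorm _).trans
            (mul_le_mul_of_nonneg_left (ContinuousLinearMap.le_opNorm _ _) (norm_nonneg _)))
      _ ≤ M * (K * ‖h‖ ^ 2 * M) := by gcongr
      _ = K * ‖h‖ ^ 2 * M ^ 2 := by ring
  have b2 : Q h (G u p) - Q h (G x p) ≤ k * K * M * ‖h‖ ^ 2 := by
    have e : Q h (G u p) - Q h (G x p) = -Q h ((G x - G u) p) := by simp
    rw [e]
    calc -Q h ((G x - G u) p) ≤ ‖Q h‖ * (‖G x - G u‖ * ‖p‖) :=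
          (neg_le_abs _).trans (((Q h).le_opNorm _).trans
            (mul_le_mul_of_nonneg_left (ContinuousLinearMap.le_opNorm _ _) (norm_nonneg _)))
      _ ≤ (k * ‖h‖) * ((K * ‖h‖) * M) := by gcongr
      _ = k * K * M * ‖h‖ ^ 2 := by ring
  have b3 : Q h (G x (Q h)) ≤ k ^ 2 * K * ‖h‖ ^ 2 := by
    calc Q h (G x (Q h)) ≤ ‖Q h‖ * (‖G x‖ * ‖Q h‖) :=
          (le_abs_self _).trans (((Q h).le_opNorm _).trans
            (mul_le_mul_of_nonneg_left (ContinuousLinearMap.le_opNorm _ _) (norm_nonneg _)))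
      _ ≤ (k * ‖h‖) * (K * (k * ‖h‖)) := by gcongr
      _ = k ^ 2 * K * ‖h‖ ^ 2 := by ring
  have hCt : 0 ≤ C * t := mul_nonneg hC ht
  have c2 := mul_le_mul_of_nonneg_left b2 hCt
  have c3 := mul_le_mul_of_nonneg_left b3 (sq_nonneg (C * t))
  have c4 := mul_le_mul_of_nonneg_left hQpos hC
  have c5 := mul_le_mul_of_nonneg_right hcond (sq_nonneg ‖h‖)
  simp only [geodesicForce_apply, map_sub, map_smul, sub_apply, smul_apply, smul_eq_mul,
    hsymm p (Q h)]
  nlinarith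

/-- A curve of speed at most `s` that leaves a ball, where `‖G‖ ≤ K`, is long. -/
theorem radius_le_of_exists_notMem_ball {G : E → (E →L[ℝ] ℝ) →L[ℝ] E} {x₀ : E} {ρ K : ℝ}
    (hK : ∀ x ∈ Metric.ball x₀ ρ, ‖G x‖ ≤ K) {η η' : ℝ → E} {s : ℝ → ℝ} {c d : ℝ}
    (hη : ContinuousOn η (Icc c d)) (hη' : ∀ r ∈ Ioo c d, HasDerivAt η (η' r) r)
    (hs : Continuous s) (hs0 : ∀ r, 0 ≤ s r)
    (hspeed : ∀ r ∈ Ioo c d, ∀ p : E →L[ℝ] ℝ, p (η' r) ^ 2 ≤ p (G (η r) p) * s r ^ 2)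
    (hc : η c = x₀) (hex : ∃ r ∈ Icc c d, η r ∉ Metric.ball x₀ ρ) :
    ρ ≤ Real.sqrt K * ∫ r in c..d, s r := by
  -- The least element e of T is the first exit time from the ball.
  set T : Set ℝ := Icc c d ∩ (fun r => ‖η r - x₀‖) ⁻¹' Ici ρ
  have hT : IsCompact T := isCompact_Icc.of_isClosed_subset
    (((hη.sub continuousOn_const).norm).preimage_isClosed_of_isClosed isClosed_Icc isClosed_Ici)
    inter_subset_left
  obtain ⟨r₁, hr₁, hr₁'⟩ := hex
  obtain ⟨e, he, hmin⟩ := hT.exists_isLeast ⟨r₁, hr₁, by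
    simpa [dist_eq_norm] using hr₁'⟩
  have hball : ∀ r ∈ Ioo c e, η r ∈ Metric.ball x₀ ρ := by
    intro r hr
    by_contra hcon
    refine absurd (hmin ⟨⟨hr.1.le, hr.2.le.trans he.1.2⟩, ?_⟩) (not_le.2 hr.2)
    simpa [dist_eq_norm] using hcon
  -- A functional of norm at most 1 that norms η e - η c reduces the estimate to a scalar function
  -- with derivative at most √K s.
  obtain ⟨p, hp, hpe⟩ := exists_dual_vector'' ℝ (η e - η c)
  have hcont : ContinuousOn (fun r => p (η r)) (Icc c e) :=
    p.continuous.comp_continuousOn (hη.mono (Icc_subset_Icc_right he.1.2))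
  have key := intervalIntegral.sub_le_integral_of_hasDeriv_right_of_le
    (g := fun r => p (η r)) (g' := fun r => p (η' r)) (φ := fun r => Real.sqrt K * s r) he.1.1 hcont
    (fun r hr => (p.hasFDerivAt.comp_hasDerivAt r
      (hη' r ⟨hr.1, hr.2.trans_le he.1.2⟩)).hasDerivWithinAt)
    ((continuous_const.mul hs).integrableOn_Icc) (by
      intro r hr
      have hb := hK _ (hball r hr)
      have hK0 : 0 ≤ K := (norm_nonneg _).trans hb
      refine (le_abs_self _).trans (abs_le_of_sq_le_sq ?_ (mul_nonneg (Real.sqrt_nonneg _) (hs0 r)))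
      rw [mul_pow, Real.sq_sqrt hK0]
      refine (hspeed r ⟨hr.1, hr.2.trans_le he.1.2⟩ p).trans
        (mul_le_mul_of_nonneg_right ?_ (sq_nonneg _))
      calc p (G (η r) p) ≤ ‖p‖ * (‖G (η r)‖ * ‖p‖) :=
            (le_abs_self _).trans ((p.le_opNorm _).trans
              (mul_le_mul_of_nonneg_left (ContinuousLinearMap.le_opNorm _ _) (norm_nonneg _)))
        _ ≤ 1 * (K * 1) := by gcongr
        _ = K := by ring)
  have h1 : p (η e) - p (η c) = ‖η e - η c‖ := by
    rw [← map_sub]; simpa using hpe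
  have h2 : ρ ≤ ‖η e - η c‖ := by rw [hc]; exact he.2
  have h3 : ∫ r in c..e, s r ≤ ∫ r in c..d, s r :=
    intervalIntegral.integral_mono_interval le_rfl he.1.1 he.1.2
      (Eventually.of_forall hs0) (hs.intervalIntegrable _ _)
  rw [intervalIntegral.integral_const_mul] at key
  have h4 := mul_le_mul_of_nonneg_left h3 (Real.sqrt_nonneg K)
  linarith

/-- A curve with the end points of a short unit speed geodesic `z` that stays in a small ball is
not shorter than the geodesic. -/
theorem le_length_of_mem_ball {G : E → (E →L[ℝ] ℝ) →L[ℝ] E} {Q : E →L[ℝ] E →L[ℝ] ℝ}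
    {x₀ : E} {ρ K M k C ε : ℝ} (hK0 : 0 ≤ K) (hk : 0 ≤ k) (hC : 0 ≤ C) (hε : 0 < ε)
    (hsymm : ∀ x ∈ Metric.ball x₀ ρ, ∀ p q : E →L[ℝ] ℝ, p (G x q) = q (G x p))
    (hpos : ∀ x ∈ Metric.ball x₀ ρ, ∀ p : E →L[ℝ] ℝ, 0 ≤ p (G x p))
    (hK : ∀ x ∈ Metric.ball x₀ ρ, ‖G x‖ ≤ K)
    (hT : ∀ x ∈ Metric.ball x₀ ρ, ∀ y ∈ Metric.ball x₀ ρ, ‖G y - G x‖ ≤ K * ‖y - x‖ ∧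
        ‖G y - G x - fderiv ℝ G x (y - x)‖ ≤ K * ‖y - x‖ ^ 2)
    (hQk : ‖Q‖ ≤ k) (hQsymm : ∀ v w, Q v w = Q w v) (hQpos : ∀ v, ‖v‖ ^ 2 ≤ Q v v)
    (hcond : ∀ t ∈ Icc 0 ε, K * M ^ 2 + 2 * C * t * k * K * M + C ^ 2 * t ^ 2 * k ^ 2 * K ≤ C)
    {z : ℝ → E × (E →L[ℝ] ℝ)} (hz : ∀ t ∈ Icc 0 ε, HasDerivAt z (hamiltonField G (z t)) t)
    (hz1 : ∀ t ∈ Icc 0 ε, (z t).1 ∈ Metric.ball x₀ ρ) (hz2 : ∀ t ∈ Icc 0 ε, ‖(z t).2‖ ≤ M)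
    (hz3 : ∀ t ∈ Icc 0 ε, (z t).2 (G (z t).1 (z t).2) = 1)
    {η η' : ℝ → E} {s : ℝ → ℝ} {c d : ℝ} (hcd : c < d)
    (hη : ContinuousOn η (Icc c d)) (hη' : ∀ r ∈ Ioo c d, HasDerivAt η (η' r) r)
    (hs : Continuous s) (hs0 : ∀ r, 0 ≤ s r)
    (hspeed : ∀ r ∈ Ioo c d, ∀ p : E →L[ℝ] ℝ, p (η' r) ^ 2 ≤ p (G (η r) p) * s r ^ 2)
    (hc : η c = (z 0).1) (hd : η d = (z ε).1) (hball : ∀ r ∈ Icc c d, η r ∈ Metric.ball x₀ ρ) :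
    ε ≤ ∫ r in c..d, s r := by
  set L := ∫ r in c..d, s r with hL
  have hL0 : 0 ≤ L := intervalIntegral.integral_nonneg hcd.le fun r _ => hs0 r
  -- The speed s may vanish; δ keeps the reparametrisation strictly increasing and tends to 0 at the
  -- end.
  suffices H : ∀ δ > 0, ε ^ 2 ≤ L * (L + δ * (d - c)) by
    have h1 : ε ^ 2 ≤ L * (L + 0 * (d - c)) := by
      have hlim : Tendsto (fun δ : ℝ => L * (L + δ * (d - c))) (𝓝[>] 0)
          (𝓝 (L * (L + 0 * (d - c)))) :=
        (Continuous.tendsto (by fun_prop) 0).mono_left nhdsWithin_le_nhds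
      exact ge_of_tendsto hlim (eventually_nhdsWithin_of_forall H)
    nlinarith
  intro δ hδ
  set D := L + δ * (d - c) with hD
  have hD0 : 0 < D := by have := mul_pos hδ (sub_pos.2 hcd); linarith
  -- The clock τ runs proportionally to s + δ, normalised so that [c, d] is mapped onto [0, ε].
  set w : ℝ → ℝ := fun r => ε * (s r + δ) / D with hw
  have hwc : Continuous w := by fun_prop
  have hwpos : ∀ r, 0 < w r := fun r => by
    have := hs0 r
    positivity
  set τ : ℝ → ℝ := fun r => ∫ y in c..r, w y with hτ
  have hτ' : ∀ r, HasDerivAt τ (w r) r := fun r =>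
    intervalIntegral.integral_hasDerivAt_right (hwc.intervalIntegrable _ _)
      (hwc.stronglyMeasurableAtFilter _ _) hwc.continuousAt
  have hτc : τ c = 0 := intervalIntegral.integral_same
  have hτd : τ d = ε := by
    have : τ d = ε * (L + δ * (d - c)) / D := by
      simp only [hτ, hw]
      rw [intervalIntegral.integral_div, intervalIntegral.integral_const_mul,
        intervalIntegral.integral_add (hs.intervalIntegrable _ _) (by simp)]
      simp [hL, mul_comm]
    rw [this, ← hD]
    field_simp
  have hτmono : StrictMono τ := strictMono_of_hasDerivAt_pos hτ' hwpos
  have hτmem : ∀ r ∈ Icc c d, τ r ∈ Icc 0 ε := fun r hr =>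
    ⟨hτc ▸ hτmono.monotone hr.1, hτd ▸ hτmono.monotone hr.2⟩
  -- The calibrating function φ of `hamiltonJacobi_quadratic_le` at time τ(r) and position η(r). Its
  -- values at the ends are 0 and ε/2, as η meets the geodesic there.
  set Φ : ℝ → ℝ := fun r => τ r / 2 + (z (τ r)).2 (η r - (z (τ r)).1) -
    C * τ r / 2 * Q (η r - (z (τ r)).1) (η r - (z (τ r)).1) with hΦ
  set Φ' : ℝ → ℝ := fun r =>
    w r * (1 / 2 + geodesicForce G (z (τ r)).1 (z (τ r)).2 (η r - (z (τ r)).1) - 1 -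
      C / 2 * Q (η r - (z (τ r)).1) (η r - (z (τ r)).1) +
      C * τ r * Q (η r - (z (τ r)).1) (G (z (τ r)).1 (z (τ r)).2)) +
    ((z (τ r)).2 - (C * τ r) • Q (η r - (z (τ r)).1)) (η' r) with hΦ'
  have hzτ : ∀ r ∈ Icc c d, HasDerivAt (fun r => z (τ r)) (w r • hamiltonField G (z (τ r))) r :=
    fun r hr => (hz _ (hτmem r hr)).scomp r (hτ' r)
  have hcont : ContinuousOn Φ (Icc c d) := by
    have h0 : ContinuousOn (fun r => z (τ r)) (Icc c d) :=
      fun r hr => (hzτ r hr).continuousAt.continuousWithinAt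
    have h1 : ContinuousOn (fun r => η r - (z (τ r)).1) (Icc c d) :=
      hη.sub (continuous_fst.comp_continuousOn h0)
    have h2 : Continuous τ := continuous_iff_continuousAt.2 fun r => (hτ' r).continuousAt
    refine ((h2.div_const 2).continuousOn.add
      ((continuous_snd.comp_continuousOn h0).clm_apply h1)).sub ?_
    exact ((continuous_const.mul h2).div_const 2).continuousOn.mul
      ((Q.continuous.comp_continuousOn h1).clm_apply h1)
  have hderiv : ∀ r ∈ Ioo c d, HasDerivAt Φ (Φ' r) r := by
    intro r hr
    have hr' : r ∈ Icc c d := Ioo_subset_Icc_self hr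
    have e0 := hzτ r hr'
    have e1 : HasDerivAt (fun r => (z (τ r)).1) (w r • G (z (τ r)).1 (z (τ r)).2) r :=
      ((hasFDerivAt_fst (𝕜 := ℝ) (p := z (τ r))).comp_hasDerivAt r e0 :)
    have e2 : HasDerivAt (fun r => (z (τ r)).2)
        (w r • geodesicForce G (z (τ r)).1 (z (τ r)).2) r :=
      ((hasFDerivAt_snd (𝕜 := ℝ) (p := z (τ r))).comp_hasDerivAt r e0 :)
    have e3 := (hη' r hr).fun_sub e1
    have e4 := (((hτ' r).div_const 2).fun_add (e2.clm_apply e3)).fun_sub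
      ((((hτ' r).const_mul C).div_const 2).fun_mul
        ((Q.hasFDerivAt.comp_hasDerivAt r e3).clm_apply e3))
    refine e4.congr_deriv ?_
    have hu := hz3 _ (hτmem r hr')
    simp only [hΦ', map_sub, map_smul, sub_apply, smul_apply, smul_eq_mul, hu, Function.comp,
      hQsymm (η' r), hQsymm (G (z (τ r)).1 (z (τ r)).2)]
    ring
  have key := intervalIntegral.sub_le_integral_of_hasDeriv_right_of_le
    (g := Φ) (g' := Φ') (φ := fun r => D / (2 * ε) * s r) hcd.le hcont
    (fun r hr => (hderiv r hr).hasDerivWithinAt)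
    ((continuous_const.mul hs).integrableOn_Icc) (by
      intro r hr
      have hr' : r ∈ Icc c d := Ioo_subset_Icc_self hr
      have hm := hτmem r hr'
      have hx := hball r hr'
      have hu := hz1 _ hm
      set π := (z (τ r)).2 - (C * τ r) • Q (η r - (z (τ r)).1) with hπ
      have hHJ := hamiltonJacobi_quadratic_le (Q := Q) hK0 hk hC hm.1 (hsymm _ hx) (hK _ hx)
        (hT _ hu _ hx).1 (hT _ hu _ hx).2 (hz2 _ hm) (hz3 _ hm)
        ((Q.le_opNorm _).trans (mul_le_mul_of_nonneg_right hQk (norm_nonneg _))) (hQpos _)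
        (hcond _ hm)
      have hsp := hspeed r hr π
      have hA := hpos _ hx π
      have hs0r := hs0 r
      have hwr := hwpos r
      -- Fenchel's inequality: the first summand is absorbed by the Hamilton–Jacobi inequality, the
      -- second is controlled by the choice of w.
      have hamgm : π (η' r) ≤ 1 / 2 * (w r * π (G (η r) π)) + 1 / 2 * (s r ^ 2 / w r) := by
        refine (le_abs_self _).trans (abs_le_of_sq_le_sq ?_ (by positivity))
        refine hsp.trans ?_
        have e : π (G (η r) π) * s r ^ 2 = (w r * π (G (η r) π)) * (s r ^ 2 / w r) := by
          field_simp
        rw [e]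
        nlinarith [sq_nonneg (w r * π (G (η r) π) - s r ^ 2 / w r)]
      have hsw : s r ^ 2 / w r ≤ D / ε * s r := by
        rw [div_le_iff₀ hwr]
        have e : D / ε * s r * w r = s r * (s r + δ) := by
          simp only [hw]; field_simp
        rw [e]
        nlinarith
      have hmul := mul_le_mul_of_nonneg_left hHJ hwr.le
      have e : D / (2 * ε) * s r = 1 / 2 * (D / ε * s r) := by field_simp
      rw [e]
      simp only [hΦ']
      linarith)
  rw [intervalIntegral.integral_const_mul, ← hL] at key
  have hΦc : Φ c = 0 := by simp [hΦ, hτc, hc]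
  have hΦd : Φ d = ε / 2 := by simp [hΦ, hτd, hd]
  rw [hΦc, hΦd] at key
  have e : D / (2 * ε) * L = L * D / ε / 2 := by field_simp
  rw [e] at key
  have : ε ≤ L * D / ε := by linarith
  rw [le_div_iff₀ hε] at this
  nlinarith

end Calibration

/-! ### Existence of short minimal geodesics -/

section ShortGeodesic

variable {E : Type*} [NormedAddCommGroup E] [NormedSpace ℝ E] [CompleteSpace E]

/-- Short geodesics exist in every direction, and no curve is shorter. -/
theorem exists_short_geodesic {G : E → (E →L[ℝ] ℝ) →L[ℝ] E} {U : Set E} (hU : IsOpen U)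
    (hG : ContDiffOn ℝ 2 G U)
    (hsymm : ∀ x ∈ U, ∀ p q : E →L[ℝ] ℝ, p (G x q) = q (G x p))
    (hpos : ∀ x ∈ U, ∀ p : E →L[ℝ] ℝ, 0 ≤ p (G x p))
    {Q : E →L[ℝ] E →L[ℝ] ℝ} (hQsymm : ∀ v w, Q v w = Q w v) (hQpos : ∀ v, ‖v‖ ^ 2 ≤ Q v v)
    {x₀ : E} (hx₀ : x₀ ∈ U) {p₀ : E →L[ℝ] ℝ} (hp₀ : p₀ (G x₀ p₀) = 1) :
    ∃ ε > 0, ∃ z : ℝ → E × (E →L[ℝ] ℝ), z 0 = (x₀, p₀) ∧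
      (∀ t ∈ Icc 0 ε, HasDerivAt z (hamiltonField G (z t)) t ∧ (z t).1 ∈ U ∧
        (z t).2 (G (z t).1 (z t).2) = 1) ∧
      ∀ (η η' : ℝ → E) (s : ℝ → ℝ) (c d : ℝ), c < d → ContinuousOn η (Icc c d) →
        (∀ r ∈ Ioo c d, HasDerivAt η (η' r) r) → Continuous s → (∀ r, 0 ≤ s r) →
        (∀ r ∈ Ioo c d, ∀ p : E →L[ℝ] ℝ, p (η' r) ^ 2 ≤ p (G (η r) p) * s r ^ 2) →
        η c = x₀ → η d = (z ε).1 → ε ≤ ∫ r in c..d, s r := by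
  obtain ⟨ρ, hρ, K, hK0, hsub, hK, hT⟩ :=
    (hG.contDiffAt (hU.mem_nhds hx₀)).exists_ball_taylor (hU.mem_nhds hx₀)
  obtain ⟨z, hz0, ε₀, hε₀, hz⟩ :=
    ((contDiffOn_hamiltonField hU hG).contDiffAt ((hU.prod isOpen_univ).mem_nhds
      (show (x₀, p₀) ∈ U ×ˢ univ from ⟨hx₀, mem_univ _⟩))
      ).exists_forall_mem_closedBall_exists_eq_forall_mem_Ioo_hasDerivAt₀ 0
  simp only [zero_sub, zero_add] at hz
  have hzc : ContinuousAt z 0 := (hz 0 ⟨by linarith, hε₀⟩).continuousAt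
  set M := ‖p₀‖ + 1 with hM
  set k := ‖Q‖ with hk
  set C := K * M ^ 2 + 1 with hC
  have ev1 : ∀ᶠ t in 𝓝 (0 : ℝ), (z t).1 ∈ Metric.ball x₀ ρ :=
    hzc.fst.eventually_mem (by rw [hz0]; exact Metric.ball_mem_nhds _ hρ)
  have ev2 : ∀ᶠ t in 𝓝 (0 : ℝ), ‖(z t).2‖ < M :=
    hzc.snd.norm.eventually_lt continuousAt_const (by rw [hz0]; simp [hM])
  -- At t = 0 the left side is K M², one less than C.
  have ev3 : ∀ᶠ t in 𝓝 (0 : ℝ), K * M ^ 2 + 2 * C * t * k * K * M + C ^ 2 * t ^ 2 * k ^ 2 * K < C :=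
    ContinuousAt.eventually_lt (by fun_prop) continuousAt_const (by simp [hC])
  -- A competitor that leaves the ball has length at least ρ/√K, which then exceeds t.
  have ev4 : ∀ᶠ t in 𝓝 (0 : ℝ), Real.sqrt K * t < ρ :=
    ContinuousAt.eventually_lt (by fun_prop) continuousAt_const (by simpa using hρ)
  have ev5 : ∀ᶠ t in 𝓝 (0 : ℝ), t < ε₀ := gt_mem_nhds hε₀
  obtain ⟨e, he, hev⟩ := Metric.eventually_nhds_iff_ball.1
    (ev1.and (ev2.and (ev3.and (ev4.and ev5))))
  have hmem : ∀ t ∈ Icc 0 (e / 2), t ∈ Metric.ball (0 : ℝ) e := fun t ht => by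
    rw [Metric.mem_ball, dist_zero_right, Real.norm_eq_abs, abs_of_nonneg ht.1]
    linarith [ht.2]
  have he2 : 0 < e / 2 := by linarith
  have hder : ∀ t ∈ Icc 0 (e / 2), HasDerivAt z (hamiltonField G (z t)) t := fun t ht =>
    hz t ⟨by linarith [ht.1], (hev t (hmem t ht)).2.2.2.2⟩
  have hb : ∀ t ∈ Icc 0 (e / 2), (z t).1 ∈ Metric.ball x₀ ρ := fun t ht => (hev t (hmem t ht)).1
  have hen : ∀ t ∈ Icc 0 (e / 2), (z t).2 (G (z t).1 (z t).2) = 1 := by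
    intro t ht
    have hd : ∀ r ∈ Icc 0 (e / 2), HasDerivAt (fun r => (z r).2 (G (z r).1 (z r).2)) 0 r := by
      intro r hr
      have hrU := hsub (hb r hr)
      exact (hasDerivWithinAt_univ.1 (hasDerivWithinAt_hamilton_energy
        ((hG.contDiffAt (hU.mem_nhds hrU)).differentiableAt two_ne_zero) (hsymm _ hrU)
        (hder r hr).hasDerivWithinAt))
    have := constant_of_has_deriv_right_zero
      (fun r hr => (hd r hr).continuousAt.continuousWithinAt)
      (fun r hr => (hd r (Ico_subset_Icc_self hr)).hasDerivWithinAt) t ht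
    rw [this, hz0]
    exact hp₀
  refine ⟨e / 2, he2, z, hz0, fun t ht => ⟨hder t ht, hsub (hb t ht), hen t ht⟩, ?_⟩
  intro η η' s c d hcd hη hη' hs hs0 hsp hc hd
  by_contra hlt
  push Not at hlt
  by_cases hex : ∃ r ∈ Icc c d, η r ∉ Metric.ball x₀ ρ
  · have h1 := radius_le_of_exists_notMem_ball hK hη hη' hs hs0 hsp hc hex
    have h2 := (hev _ (hmem (e / 2) (right_mem_Icc.2 he2.le))).2.2.2.1
    have h3 := mul_le_mul_of_nonneg_left hlt.le (Real.sqrt_nonneg K)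
    linarith
  · push Not at hex
    refine absurd (le_length_of_mem_ball (M := M) (C := C) hK0 (norm_nonneg Q) (by positivity) he2
      (fun x hx => hsymm x (hsub hx)) (fun x hx => hpos x (hsub hx)) hK hT le_rfl hQsymm hQpos
      (fun t ht => (hev t (hmem t ht)).2.2.1.le) hder hb
      (fun t ht => (hev t (hmem t ht)).2.1.le) hen hcd hη hη' hs hs0 hsp (by rw [hc, hz0]) hd hex)
      (not_le.2 hlt)

end ShortGeodesic

/-! ### Smoothness of the determinant and the inverse matrix -/

section Matrix

theorem ContDiffOn.matrix_det {E ι : Type*} [NormedAddCommGroup E] [NormedSpace ℝ E] [Fintype ι]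
    [DecidableEq ι] {A : E → Matrix ι ι ℝ} {U : Set E} {k : WithTop ℕ∞}
    (hA : ∀ i j, ContDiffOn ℝ k (fun x => A x i j) U) : ContDiffOn ℝ k (fun x => (A x).det) U := by
  simp only [Matrix.det_apply]
  exact ContDiffOn.sum fun τ _ => (contDiffOn_prod fun i _ => hA _ _).const_smul _

theorem ContDiffOn.matrix_inv {E ι : Type*} [NormedAddCommGroup E] [NormedSpace ℝ E] [Fintype ι]
    [DecidableEq ι] {A : E → Matrix ι ι ℝ} {U : Set E} {k : WithTop ℕ∞}
    (hA : ∀ i j, ContDiffOn ℝ k (fun x => A x i j) U) (h0 : ∀ x ∈ U, (A x).det ≠ 0) (i j : ι) :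
    ContDiffOn ℝ k (fun x => (A x)⁻¹ i j) U := by
  have hadj : ContDiffOn ℝ k (fun x => (A x).adjugate i j) U := by
    simp only [Matrix.adjugate_apply]
    refine ContDiffOn.matrix_det fun a b => ?_
    simp only [Matrix.updateRow_apply]
    split_ifs
    · exact contDiffOn_const
    · exact hA a b
  refine (((ContDiffOn.matrix_det hA).inv h0).mul hadj).congr fun x _ => ?_
  simp [Matrix.inv_def]

end Matrix

/-! ### The inverse metric, and lengths of curves -/

namespace StatisticalManifold

variable {n : ℕ} (X : StatisticalManifold n)

/-- The components of a covector. -/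
def covComponents (p : (Fin n → ℝ) →L[ℝ] ℝ) : Fin n → ℝ := fun j => p (Pi.single j 1)

theorem apply_eq_dotProduct (p : (Fin n → ℝ) →L[ℝ] ℝ) (v : Fin n → ℝ) :
    p v = dotProduct (covComponents p) v := by
  conv_lhs => rw [← Finset.univ_sum_single v, map_sum]
  refine Finset.sum_congr rfl fun i _ => ?_
  rw [show (Pi.single i (v i) : Fin n → ℝ) = v i • Pi.single i 1 by
    rw [← Pi.single_smul, smul_eq_mul, mul_one], map_smul, smul_eq_mul, mul_comm]
  rfl

theorem covComponents_eq_zero {p : (Fin n → ℝ) →L[ℝ] ℝ} (h : covComponents p = 0) : p = 0 := by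
  ext v
  rw [apply_eq_dotProduct, h, zero_dotProduct]
  rfl

/-- The inverse metric, as a map from covectors to vectors. -/
noncomputable def cometric (x : Fin n → ℝ) : ((Fin n → ℝ) →L[ℝ] ℝ) →L[ℝ] (Fin n → ℝ) :=
  ∑ i, ∑ j, (X.g x)⁻¹ i j •
    (ContinuousLinearMap.apply ℝ ℝ (Pi.single j 1 : Fin n → ℝ)).smulRight
      (Pi.single i 1 : Fin n → ℝ)

theorem cometric_apply (x : Fin n → ℝ) (p : (Fin n → ℝ) →L[ℝ] ℝ) :
    X.cometric x p = Matrix.mulVec (X.g x)⁻¹ (covComponents p) := by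
  ext k
  simp [cometric, Matrix.mulVec, dotProduct, covComponents, Finset.sum_apply, Pi.single_apply]

theorem contDiffOn_cometric : ContDiffOn ℝ 2 X.cometric X.carrier :=
  ContDiffOn.sum fun i _ => ContDiffOn.sum fun j _ =>
    (ContDiffOn.matrix_inv X.g_contDiffOn (fun x hx => (X.g_posDef x hx).det_pos.ne') i j).smul
      contDiffOn_const

variable {X} {x : Fin n → ℝ}

theorem apply_cometric (p q : (Fin n → ℝ) →L[ℝ] ℝ) :
    p (X.cometric x q) =
      dotProduct (covComponents p) (Matrix.mulVec (X.g x)⁻¹ (covComponents q)) := by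
  rw [apply_eq_dotProduct, cometric_apply]

theorem isSymm_of_posDef {A : Matrix (Fin n) (Fin n) ℝ} (hA : A.PosDef) : A.transpose = A := by
  simpa [Matrix.IsHermitian, Matrix.conjTranspose_eq_transpose_of_trivial] using hA.isHermitian

theorem dotProduct_mulVec_comm {A : Matrix (Fin n) (Fin n) ℝ} (hA : A.PosDef) (a b : Fin n → ℝ) :
    dotProduct a (Matrix.mulVec A b) = dotProduct b (Matrix.mulVec A a) := by
  rw [Matrix.dotProduct_mulVec, ← Matrix.mulVec_transpose, isSymm_of_posDef hA, dotProduct_comm]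

theorem cometric_symm (hx : x ∈ X.carrier) (p q : (Fin n → ℝ) →L[ℝ] ℝ) :
    p (X.cometric x q) = q (X.cometric x p) := by
  rw [apply_cometric, apply_cometric, dotProduct_mulVec_comm (X.g_posDef x hx).inv]

theorem cometric_pos (hx : x ∈ X.carrier) {p : (Fin n → ℝ) →L[ℝ] ℝ} (hp : p ≠ 0) :
    0 < p (X.cometric x p) := by
  rw [apply_cometric]
  have := (X.g_posDef x hx).inv.dotProduct_mulVec_pos (x := covComponents p)
    fun h => hp (covComponents_eq_zero h)
  simpa using this

theorem cometric_nonneg (hx : x ∈ X.carrier) (p : (Fin n → ℝ) →L[ℝ] ℝ) :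
    0 ≤ p (X.cometric x p) := by
  rcases eq_or_ne p 0 with rfl | hp
  · simp
  · exact (cometric_pos hx hp).le

theorem mulVec_mulVec_inv (hx : x ∈ X.carrier) (a : Fin n → ℝ) :
    Matrix.mulVec (X.g x) (Matrix.mulVec (X.g x)⁻¹ a) = a := by
  rw [Matrix.mulVec_mulVec, Matrix.mul_nonsing_inv _ ((X.g_posDef x hx).det_pos.ne'.isUnit),
    Matrix.one_mulVec]

theorem normSq_cometric (hx : x ∈ X.carrier) (p : (Fin n → ℝ) →L[ℝ] ℝ) :
    X.normSq x (X.cometric x p) = p (X.cometric x p) := by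
  rw [normSq, cometric_apply, mulVec_mulVec_inv hx, dotProduct_comm, ← cometric_apply,
    ← apply_eq_dotProduct]

theorem normSq_nonneg (hx : x ∈ X.carrier) (v : Fin n → ℝ) : 0 ≤ X.normSq x v := by
  simpa [normSq] using (X.g_posDef x hx).posSemidef.dotProduct_mulVec_nonneg v

theorem cometric_surjective (hx : x ∈ X.carrier) (v : Fin n → ℝ) : ∃ p, X.cometric x p = v := by
  refine ⟨LinearMap.toContinuousLinearMap
    (dotProductBilin ℝ ℝ (Matrix.mulVec (X.g x) v)), ?_⟩
  rw [cometric_apply]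
  have : covComponents (LinearMap.toContinuousLinearMap
    (dotProductBilin ℝ ℝ (Matrix.mulVec (X.g x) v))) = Matrix.mulVec (X.g x) v := by
    ext j
    simp [covComponents, dotProductBilin]
  rw [this, Matrix.mulVec_mulVec, Matrix.nonsing_inv_mul _ ((X.g_posDef x hx).det_pos.ne'.isUnit),
    Matrix.one_mulVec]

/-- The Cauchy–Schwarz inequality between covectors and vectors. -/
theorem apply_sq_le (hx : x ∈ X.carrier) (p : (Fin n → ℝ) →L[ℝ] ℝ) (v : Fin n → ℝ) :
    p v ^ 2 ≤ p (X.cometric x p) * X.normSq x v := by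
  obtain ⟨q, rfl⟩ := cometric_surjective hx v
  rw [normSq_cometric hx]
  have h : ∀ t : ℝ, 0 ≤ q (X.cometric x q) * (t * t) + 2 * p (X.cometric x q) * t +
      p (X.cometric x p) := by
    intro t
    have := cometric_nonneg hx (p + t • q)
    simp only [map_add, map_smul, add_apply, smul_apply, smul_eq_mul, cometric_symm hx q p] at this
    linarith
  have := discrim_le_zero h
  simp only [discrim] at this
  linarith

theorem continuousOn_normSq :
    ContinuousOn (fun z : (Fin n → ℝ) × (Fin n → ℝ) => X.normSq z.1 z.2) (X.carrier ×ˢ univ) := by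
  simp only [normSq, dotProduct, Matrix.mulVec]
  refine continuousOn_finsetSum _ fun i _ => ContinuousOn.mul (by fun_prop) ?_
  refine continuousOn_finsetSum _ fun j _ => ContinuousOn.mul ?_ (by fun_prop)
  exact (X.g_contDiffOn i j).continuousOn.comp continuousOn_fst fun z hz => hz.1

/-- The speed of a curve. -/
noncomputable def speed (X : StatisticalManifold n) (γ : ℝ → Fin n → ℝ) (a b t : ℝ) : ℝ :=
  Real.sqrt (X.normSq (γ t) (derivWithin γ (Icc a b) t))

theorem IsCurve.continuousOn_speed {γ : ℝ → Fin n → ℝ} {a b : ℝ} (h : X.IsCurve γ a b)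
    (hab : a < b) : ContinuousOn (X.speed γ a b) (Icc a b) := by
  refine ContinuousOn.sqrt ?_
  exact continuousOn_normSq.comp (f := fun t => (γ t, derivWithin γ (Icc a b) t))
    (h.contDiffOn.continuousOn.prodMk
      (h.contDiffOn.continuousOn_derivWithin (uniqueDiffOn_Icc hab) le_rfl))
    fun t ht => ⟨h.mapsTo ht, mem_univ _⟩

/-- A continuous extension of the speed of a curve to all times. -/
theorem IsCurve.exists_continuous_speed {γ : ℝ → Fin n → ℝ} {a b : ℝ} (h : X.IsCurve γ a b)
    (hab : a < b) : ∃ s : ℝ → ℝ, Continuous s ∧ (∀ r, 0 ≤ s r) ∧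
      (∀ r ∈ Ioo a b, HasDerivAt γ (deriv γ r) r) ∧
      (∀ r ∈ Ioo a b, ∀ p : (Fin n → ℝ) →L[ℝ] ℝ,
        p (deriv γ r) ^ 2 ≤ p (X.cometric (γ r) p) * s r ^ 2) ∧
      X.length γ a b = ∫ r in a..b, s r := by
  refine ⟨IccExtend hab.le ((Icc a b).domRestrict (X.speed γ a b)),
    (continuousOn_iff_continuous_domRestrict.1 (h.continuousOn_speed hab)).Icc_extend',
    fun r => Real.sqrt_nonneg _, ?_, ?_, ?_⟩
  · intro r hr
    exact ((h.contDiffOn.contDiffAt (Icc_mem_nhds hr.1 hr.2)).differentiableAt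
      one_ne_zero).hasDerivAt
  · intro r hr p
    have hr' := Ioo_subset_Icc_self hr
    rw [IccExtend_of_mem _ _ hr', domRestrict_apply, speed,
      Real.sq_sqrt (normSq_nonneg (h.mapsTo hr') _), derivWithin_of_mem_nhds
        (Icc_mem_nhds hr.1 hr.2)]
    exact apply_sq_le (h.mapsTo hr') _ _
  · refine intervalIntegral.integral_congr fun r hr => ?_
    rw [uIcc_of_le hab.le] at hr
    simp only [IccExtend_of_mem _ _ hr]
    rfl

theorem length_nonneg {γ : ℝ → Fin n → ℝ} {a b : ℝ} (hab : a ≤ b) : 0 ≤ X.length γ a b :=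
  intervalIntegral.integral_nonneg hab fun _ _ => Real.sqrt_nonneg _

/-- A curve given by its derivatives. -/
theorem isCurve_of_hasDerivWithinAt {γ γ' : ℝ → Fin n → ℝ} {a b : ℝ} (hab : a < b)
    (hγ : ∀ t ∈ Icc a b, HasDerivWithinAt γ (γ' t) (Icc a b) t)
    (hγ' : ContinuousOn γ' (Icc a b)) (hm : MapsTo γ (Icc a b) X.carrier) : X.IsCurve γ a b := by
  refine ⟨hab.le, ?_, hm⟩
  have hd : ∀ t ∈ Icc a b, derivWithin γ (Icc a b) t = γ' t := fun t ht =>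
    (hγ t ht).derivWithin (uniqueDiffOn_Icc hab t ht)
  exact (contDiffOn_one_iff_derivWithin (uniqueDiffOn_Icc hab)).2
    ⟨fun t ht => (hγ t ht).differentiableWithinAt, hγ'.congr hd⟩

/-- The length of a part of a unit speed curve. -/
theorem length_of_hasDerivWithinAt {γ γ' : ℝ → Fin n → ℝ} {a b c d : ℝ}
    (hγ : ∀ t ∈ Icc a b, HasDerivWithinAt γ (γ' t) (Icc a b) t)
    (h1 : ∀ t ∈ Icc a b, X.normSq (γ t) (γ' t) = 1) (hcd : c < d) (hac : a ≤ c) (hdb : d ≤ b) :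
    X.length γ c d = d - c := by
  have : ∀ t ∈ uIcc c d, Real.sqrt (X.normSq (γ t) (derivWithin γ (Icc c d) t)) = 1 := by
    intro t ht
    rw [uIcc_of_le hcd.le] at ht
    have ht' : t ∈ Icc a b := ⟨hac.trans ht.1, ht.2.trans hdb⟩
    rw [((hγ t ht').mono (Icc_subset_Icc hac hdb)).derivWithin (uniqueDiffOn_Icc hcd t ht), h1 t ht',
      Real.sqrt_one]
  rw [length, intervalIntegral.integral_congr this]
  simp

end StatisticalManifold

/-! ### Minimal geodesics in every direction -/

namespace StatisticalManifold

variable {n : ℕ} {X : StatisticalManifold n}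

/-- The Euclidean inner product as a continuous bilinear form for the supremum norm. -/
noncomputable def euclideanForm (n : ℕ) : (Fin n → ℝ) →L[ℝ] (Fin n → ℝ) →L[ℝ] ℝ :=
  ∑ i, (ContinuousLinearMap.proj (R := ℝ) (φ := fun _ : Fin n => ℝ) i).smulRight
    (ContinuousLinearMap.proj (R := ℝ) (φ := fun _ : Fin n => ℝ) i)

theorem euclideanForm_apply (v w : Fin n → ℝ) : euclideanForm n v w = ∑ i, v i * w i := by
  simp [euclideanForm]

theorem norm_sq_le_euclideanForm (v : Fin n → ℝ) : ‖v‖ ^ 2 ≤ euclideanForm n v v := by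
  have h0 : 0 ≤ euclideanForm n v v := by
    rw [euclideanForm_apply]
    exact Finset.sum_nonneg fun i _ => mul_self_nonneg _
  rw [← Real.le_sqrt (norm_nonneg _) h0]
  refine (pi_norm_le_iff_of_nonneg (Real.sqrt_nonneg _)).2 fun i => ?_
  refine Real.le_sqrt_of_sq_le ?_
  rw [euclideanForm_apply, Real.norm_eq_abs, sq_abs, sq]
  exact Finset.single_le_sum (f := fun i => v i * v i) (fun i _ => mul_self_nonneg _)
    (Finset.mem_univ i)

/-- Geodesics, in the sense of curves of minimal length, exist in every direction. -/
theorem exists_isGeodesic {x : Fin n → ℝ} (hx : x ∈ X.carrier) {p : (Fin n → ℝ) →L[ℝ] ℝ}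
    (hp : p (X.cometric x p) = 1) :
    ∃ ε > 0, ∃ z : ℝ → (Fin n → ℝ) × ((Fin n → ℝ) →L[ℝ] ℝ), z 0 = (x, p) ∧
      (∀ t ∈ Icc 0 ε, HasDerivAt z (hamiltonField X.cometric (z t)) t ∧ (z t).1 ∈ X.carrier) ∧
      (∀ t ∈ Ioc 0 ε, X.length (fun t => (z t).1) 0 t = t) ∧
      X.IsGeodesic (fun t => (z t).1) 0 ε ∧ X.IsUnitSpeed (fun t => (z t).1) 0 ε := by
  obtain ⟨ε, hε, z, hz0, hz, hmin⟩ := exists_short_geodesic X.isOpen_carrier X.contDiffOn_cometric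
    (fun x hx => cometric_symm hx) (fun x hx => cometric_nonneg hx) (Q := euclideanForm n)
    (fun v w => by simp [euclideanForm_apply, mul_comm]) norm_sq_le_euclideanForm hx hp
  have hd : ∀ t ∈ Icc 0 ε, HasDerivWithinAt (fun t => (z t).1) (X.cometric (z t).1 (z t).2)
      (Icc 0 ε) t := fun t ht =>
    ((hasFDerivAt_fst (𝕜 := ℝ) (p := z t)).comp_hasDerivAt t (hz t ht).1 :).hasDerivWithinAt
  have hunit : ∀ t ∈ Icc 0 ε, X.normSq (z t).1 (X.cometric (z t).1 (z t).2) = 1 := fun t ht => by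
    rw [normSq_cometric (hz t ht).2.1, (hz t ht).2.2]
  have hzc : ContinuousOn z (Icc 0 ε) := fun t ht =>
    (hz t ht).1.continuousAt.continuousWithinAt
  have hcont : ContinuousOn (fun t => X.cometric (z t).1 (z t).2) (Icc 0 ε) :=
    (X.contDiffOn_cometric.continuousOn.comp (continuous_fst.comp_continuousOn hzc)
      fun t ht => (hz t ht).2.1).clm_apply (continuous_snd.comp_continuousOn hzc)
  have hlen : ∀ t ∈ Ioc 0 ε, X.length (fun t => (z t).1) 0 t = t := fun t ht => by
    rw [length_of_hasDerivWithinAt hd hunit ht.1 le_rfl ht.2, sub_zero]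
  refine ⟨ε, hε, z, hz0, fun t ht => ⟨(hz t ht).1, (hz t ht).2.1⟩, hlen,
    ⟨isCurve_of_hasDerivWithinAt hε hd hcont fun t ht => (hz t ht).2.1, ?_⟩, fun t ht => ?_⟩
  · intro η c d hη hc hd'
    rw [hlen ε ⟨hε, le_rfl⟩]
    -- A competitor on a one-point interval forces the geodesic to close up; a constant curve on [0,
    -- 1] then contradicts minimality.
    rcases hη.le.eq_or_lt with rfl | hcd
    · have h := hmin (fun _ => x) (fun _ => 0) (fun _ => 0) 0 1 one_pos continuousOn_const
        (fun r _ => hasDerivAt_const r x) continuous_const (fun _ => le_rfl) (by simp) rfl (by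
          have : η c = x := by rw [hc]; simp [hz0]
          rw [← this, hd'])
      simp only [intervalIntegral.integral_zero] at h
      exact absurd h (not_le.2 hε)
    · obtain ⟨s, hs, hs0, hη', hsp, hl⟩ := hη.exists_continuous_speed hcd
      rw [hl]
      exact hmin η _ s c d hcd hη.contDiffOn.continuousOn hη' hs hs0 hsp
        (by rw [hc]; simp [hz0]) hd'
  · rw [(hd t ht).derivWithin (uniqueDiffOn_Icc hε t ht)]
    exact hunit t ht

end StatisticalManifold

/-! ### The Hessian equation, the constant S + ψ²/2, and compact superlevel sets -/

namespace FluctuationGeometry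

open StatisticalManifold

variable {n : ℕ} {F : FluctuationGeometry n} {x : Fin n → ℝ}

theorem differentiableAt_S (hx : x ∈ F.carrier) : DifferentiableAt ℝ F.S x :=
  (F.S_contDiffOn.contDiffAt (F.isOpen_carrier.mem_nhds hx)).differentiableAt two_ne_zero

theorem contDiffOn_fderiv_S : ContDiffOn ℝ 1 (fderiv ℝ F.S) F.carrier :=
  F.S_contDiffOn.fderiv_of_isOpen F.isOpen_carrier (by norm_num)

theorem differentiableAt_fderiv_S (hx : x ∈ F.carrier) : DifferentiableAt ℝ (fderiv ℝ F.S) x :=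
  (contDiffOn_fderiv_S.contDiffAt (F.isOpen_carrier.mem_nhds hx)).differentiableAt one_ne_zero

theorem differentiableAt_cometric (hx : x ∈ F.carrier) : DifferentiableAt ℝ F.cometric x :=
  (F.contDiffOn_cometric.contDiffAt (F.isOpen_carrier.mem_nhds hx)).differentiableAt two_ne_zero

/-- The postulate on the dissipation, as a differential equation: the covariant Hessian of the
information potential is the negative of the metric. -/
theorem geodesicHessian_eq (hx : x ∈ F.carrier) (p : (Fin n → ℝ) →L[ℝ] ℝ) :
    geodesicHessian F.cometric F.S x p = -p (F.cometric x p) := by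
  have key : ∀ p : (Fin n → ℝ) →L[ℝ] ℝ, p (F.cometric x p) = 1 →
      geodesicHessian F.cometric F.S x p = -1 := by
    intro p hp
    obtain ⟨ε, hε, z, hz0, hz, hlen, hgeo, hunit⟩ := exists_isGeodesic hx hp
    have h0 : (0 : ℝ) ∈ Icc 0 ε := left_mem_Icc.2 hε.le
    have hΦ : ∀ t ∈ Icc 0 ε, derivWithin (F.S ∘ fun t => (z t).1) (Icc 0 ε) t =
        fderiv ℝ F.S (z t).1 (F.cometric (z t).1 (z t).2) := by
      intro t ht
      have h1 : HasDerivAt (fun t => (z t).1) (F.cometric (z t).1 (z t).2) t :=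
        ((hasFDerivAt_fst (𝕜 := ℝ) (p := z t)).comp_hasDerivAt t (hz t ht).1 :)
      exact ((differentiableAt_S (hz t ht).2).hasFDerivAt.comp_hasDerivAt (f := fun t => (z t).1) t
        h1).hasDerivWithinAt.derivWithin (uniqueDiffOn_Icc hε t ht)
    -- The postulate makes the dissipation affine of slope -1; comparing derivatives at time 0 gives
    -- the value of the Hessian.
    have hlin : ∀ t ∈ Icc 0 ε, fderiv ℝ F.S (z t).1 (F.cometric (z t).1 (z t).2) =
        fderiv ℝ F.S (z 0).1 (F.cometric (z 0).1 (z 0).2) - t := by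
      intro t ht
      rcases ht.1.eq_or_lt with rfl | ht0
      · simp
      · have := F.length_eq_dissipation_drop _ 0 ε hε hgeo hunit 0 h0 t ht ht0
        rw [hlen t ⟨ht0, ht.2⟩, hΦ 0 h0, hΦ t ht] at this
        linarith
    have hx0 : (z 0).1 ∈ F.carrier := (hz 0 h0).2
    have d1 := hasDerivWithinAt_fderiv_hamilton (differentiableAt_cometric hx0)
      (cometric_symm hx0) (differentiableAt_fderiv_S hx0)
      ((hz 0 h0).1.hasDerivWithinAt (s := Icc 0 ε))
    have d2 : HasDerivWithinAt (fun t => fderiv ℝ F.S (z t).1 (F.cometric (z t).1 (z t).2)) (-1)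
        (Icc 0 ε) 0 :=
      (((hasDerivAt_id (0 : ℝ)).const_sub _).hasDerivWithinAt).congr hlin (hlin 0 h0)
    have := (uniqueDiffOn_Icc hε 0 h0).eq_deriv _ d1 d2
    rwa [hz0] at this
  -- Both sides are homogeneous of degree 2 in p, so unit covectors suffice.
  rcases eq_or_ne p 0 with rfl | hp
  · simp [geodesicHessian]
  · have hpos := cometric_pos (X := F.toStatisticalManifold) hx hp
    set c := Real.sqrt (p (F.cometric x p)) with hc
    have hc0 : c ≠ 0 := (Real.sqrt_pos.2 hpos).ne'
    have hc2 : c ^ 2 = p (F.cometric x p) := Real.sq_sqrt hpos.le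
    have := key (c⁻¹ • p) (by
      simp only [map_smul, smul_apply, smul_eq_mul, ← hc2]
      field_simp)
    simp only [geodesicHessian, map_smul, smul_apply, smul_eq_mul] at this ⊢
    field_simp at this
    rw [← hc2]
    linarith

/-- The squared norm `ψ²` of the differential of the information potential. -/
theorem gradNorm_sq (hx : x ∈ F.carrier) :
    F.gradNorm x ^ 2 = fderiv ℝ F.S x (F.cometric x (fderiv ℝ F.S x)) := by
  have h : dotProduct (F.gradContra x) (F.gradCov x) =
      fderiv ℝ F.S x (F.cometric x (fderiv ℝ F.S x)) := by
    have e : F.gradCov x = -covComponents (fderiv ℝ F.S x) := rfl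
    rw [gradContra, e, Matrix.mulVec_neg, neg_dotProduct_neg, dotProduct_comm, apply_cometric]
  rw [gradNorm, h, Real.sq_sqrt (cometric_nonneg (X := F.toStatisticalManifold) hx _)]

theorem gradNorm_nonneg : 0 ≤ F.gradNorm x := Real.sqrt_nonneg _

theorem gradNorm_eq_zero_iff (hx : x ∈ F.carrier) : F.gradNorm x = 0 ↔ fderiv ℝ F.S x = 0 := by
  rw [← sq_eq_zero_iff, gradNorm_sq hx]
  refine ⟨fun h => ?_, fun h => by simp [h]⟩
  by_contra hne
  exact (cometric_pos (X := F.toStatisticalManifold) hx hne).ne' h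

/-- `S + ½ ψ²` is constant. -/
theorem exists_S_add_gradNorm_sq (F : FluctuationGeometry n) :
    ∃ m, ∀ x ∈ F.carrier, F.S x + F.gradNorm x ^ 2 / 2 = m := by
  set f : (Fin n → ℝ) → ℝ := fun y => fderiv ℝ F.S y (F.cometric y (fderiv ℝ F.S y)) with hf
  have hmain : ∀ x ∈ F.carrier, DifferentiableAt ℝ f x ∧ fderiv ℝ f x = (-2 : ℝ) • fderiv ℝ F.S x := by
    intro x hx
    have h := fun q => fderiv_gradient_sq_of_geodesicHessian F.isOpen_carrier F.contDiffOn_cometric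
      F.S_contDiffOn (fun x hx => cometric_symm hx) hx (geodesicHessian_eq hx) q
    refine ⟨(h 0).1.differentiableAt, ?_⟩
    ext v
    obtain ⟨q, rfl⟩ := cometric_surjective (X := F.toStatisticalManifold) hx v
    simpa using (h q).2
  obtain ⟨m, hm⟩ := F.isOpen_carrier.exists_is_const_of_fderiv_eq_zero (𝕜 := ℝ)
    (f := fun x => F.S x + (1 / 2 : ℝ) * f x) F.isConnected_carrier.isPreconnected
    (fun x hx => ((differentiableAt_S hx).fun_add
      ((hmain x hx).1.const_mul _)).differentiableWithinAt) (fun x hx => by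
      rw [fderiv_fun_add (differentiableAt_S hx) ((hmain x hx).1.const_mul _),
        fderiv_const_mul (hmain x hx).1, (hmain x hx).2]
      ext v
      simp)
  refine ⟨m, fun x hx => ?_⟩
  rw [gradNorm_sq hx, ← hm x hx]
  simp only [hf]
  ring

/-- The superlevel sets of the information potential are compact. -/
theorem isCompact_superlevel (F : FluctuationGeometry n) (c : ℝ) :
    IsCompact {x ∈ F.carrier | c ≤ F.S x} := by
  have h := F.weight_tendsto.eventually_lt_const (Real.exp_pos c)
  obtain ⟨t, ht, hsub⟩ := mem_cocompact.1 h
  have hS : Continuous fun x : F.carrier => F.S x :=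
    continuousOn_iff_continuous_domRestrict.1 F.S_contDiffOn.continuousOn
  have hcl : IsClosed {x : F.carrier | c ≤ F.S x} := isClosed_le continuous_const hS
  have hc : IsCompact {x : F.carrier | c ≤ F.S x} := by
    refine ht.of_isClosed_subset hcl fun x hx => ?_
    by_contra hxt
    have := hsub hxt
    simp only [mem_ofPred_eq, Real.exp_lt_exp] at this hx
    linarith
  convert hc.image continuous_subtype_val using 1
  ext x
  simp [and_comm]

end FluctuationGeometry

/-! ### The maximum point and uniqueness of the critical point -/

namespace FluctuationGeometry

open StatisticalManifold

variable {n : ℕ} {F : FluctuationGeometry n} {x p q : Fin n → ℝ} {m : ℝ}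

theorem exists_isMaxOn (F : FluctuationGeometry n) : ∃ p ∈ F.carrier, IsMaxOn F.S F.carrier p := by
  obtain ⟨x₁, hx₁⟩ := F.isConnected_carrier.nonempty
  obtain ⟨p, hp, hmax⟩ := (F.isCompact_superlevel (F.S x₁)).exists_isMaxOn ⟨x₁, hx₁, le_rfl⟩
    (F.S_contDiffOn.continuousOn.mono fun x hx => hx.1)
  refine ⟨p, hp.1, fun x hx => ?_⟩
  rcases le_total (F.S x₁) (F.S x) with h | h
  · exact hmax ⟨hx, h⟩
  · exact h.trans hp.2

theorem fderiv_S_eq_zero (hp : p ∈ F.carrier) (hmax : IsMaxOn F.S F.carrier p) :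
    fderiv ℝ F.S p = 0 :=
  (hmax.isLocalMax (F.isOpen_carrier.mem_nhds hp)).fderiv_eq_zero

/-- At a critical point the Hessian equation involves only the second derivative of S, which is
therefore nondegenerate; so the zero of the differential is isolated. -/
theorem eventually_fderiv_S_ne_zero (hp : p ∈ F.carrier) (h0 : fderiv ℝ F.S p = 0) :
    ∀ᶠ x in 𝓝[≠] p, fderiv ℝ F.S x ≠ 0 := by
  refine (differentiableAt_fderiv_S hp).hasFDerivAt.eventually_ne ?_
  have hker : LinearMap.ker (fderiv ℝ (fderiv ℝ F.S) p).toLinearMap = ⊥ := by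
    refine (Submodule.eq_bot_iff _).2 fun v hv => ?_
    obtain ⟨q, rfl⟩ := cometric_surjective (X := F.toStatisticalManifold) hp v
    have hv' : fderiv ℝ (fderiv ℝ F.S) p (F.cometric p q) = 0 := hv
    have := geodesicHessian_eq hp q
    simp only [geodesicHessian, h0, hv', map_zero, zero_apply] at this
    by_contra hne
    have hq : q ≠ 0 := fun h => hne (by simp [h])
    have := cometric_pos (X := F.toStatisticalManifold) hp hq
    linarith
  obtain ⟨K, -, hK⟩ := LinearMap.exists_antilipschitzWith _ hker
  exact ⟨K, hK⟩

/-- The gradient of the information potential. -/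
noncomputable def gradient (F : FluctuationGeometry n) (x : Fin n → ℝ) : Fin n → ℝ :=
  F.cometric x (fderiv ℝ F.S x)

theorem continuousOn_gradient : ContinuousOn F.gradient F.carrier :=
  F.contDiffOn_cometric.continuousOn.clm_apply contDiffOn_fderiv_S.continuousOn

theorem norm_gradient_sq_le (hx : x ∈ F.carrier) :
    ‖F.gradient x‖ ^ 2 ≤ ‖F.cometric x‖ * F.gradNorm x ^ 2 := by
  obtain ⟨p, hp, hpe⟩ := exists_dual_vector'' ℝ (F.gradient x)
  have h1 := apply_sq_le (X := F.toStatisticalManifold) hx p (F.gradient x)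
  rw [gradient, normSq_cometric hx, ← gradNorm_sq hx, ← gradient, hpe] at h1
  refine h1.trans (mul_le_mul_of_nonneg_right ?_ (sq_nonneg _))
  calc p (F.cometric x p) ≤ ‖p‖ * (‖F.cometric x‖ * ‖p‖) :=
        (le_abs_self _).trans ((p.le_opNorm _).trans
          (mul_le_mul_of_nonneg_left (ContinuousLinearMap.le_opNorm _ _) (norm_nonneg _)))
    _ ≤ 1 * (‖F.cometric x‖ * 1) := by gcongr
    _ = ‖F.cometric x‖ := by ring

/-- A small step along the gradient decreases `m - S` by a definite factor. -/
theorem eventually_gradient_step (hm : ∀ x ∈ F.carrier, F.S x + F.gradNorm x ^ 2 / 2 = m)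
    (hx : x ∈ F.carrier) : ∀ᶠ z : ℝ × (Fin n → ℝ) in 𝓝 (0, x), z.2 ∈ F.carrier → 0 < z.1 →
      z.2 + z.1 • F.gradient z.2 ∈ F.carrier ∧
      m - F.S (z.2 + z.1 • F.gradient z.2) ≤ (1 - z.1) * (m - F.S z.2) := by
  obtain ⟨ρ, hρ, K, hK0, hsub, -, hT⟩ :=
    (F.S_contDiffOn.contDiffAt (F.isOpen_carrier.mem_nhds hx)).exists_ball_taylor
      (F.isOpen_carrier.mem_nhds hx)
  set B := ‖F.cometric x‖ + 1 with hB
  have hcx : ContinuousAt F.cometric x := (differentiableAt_cometric hx).continuousAt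
  have hgx : ContinuousAt F.gradient x :=
    continuousOn_gradient.continuousAt (F.isOpen_carrier.mem_nhds hx)
  have hc2 : ContinuousAt (fun z : ℝ × (Fin n → ℝ) => z.2) (0, x) := continuousAt_snd
  have hc1 : ContinuousAt (fun z : ℝ × (Fin n → ℝ) => z.1) (0, x) := continuousAt_fst
  have hg2 : ContinuousAt (fun z : ℝ × (Fin n → ℝ) => F.gradient z.2) (0, x) :=
    hgx.comp' (f := fun z : ℝ × (Fin n → ℝ) => z.2) (x := (0, x)) hc2
  have hstep : ContinuousAt (fun z : ℝ × (Fin n → ℝ) => z.2 + z.1 • F.gradient z.2) (0, x) :=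
    hc2.add (hc1.smul hg2)
  have e1 := hc2.eventually_mem (Metric.ball_mem_nhds x hρ)
  have e2 := hstep.eventually_mem (s := Metric.ball x ρ) (by simpa using Metric.ball_mem_nhds x hρ)
  have e3 : ∀ᶠ z : ℝ × (Fin n → ℝ) in 𝓝 (0, x), ‖F.cometric z.2‖ < B :=
    (hcx.norm.comp' (f := fun z : ℝ × (Fin n → ℝ) => z.2) (x := (0, x)) hc2).eventually_lt
      continuousAt_const (by simp [hB])
  -- With step τ the Taylor remainder is at most K B τ² ψ² ≤ τ ψ²/2, half of the first order gain τ
  -- ψ². The other half is τ (m - S).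
  have e4 : ∀ᶠ z : ℝ × (Fin n → ℝ) in 𝓝 (0, x), K * B * z.1 < 1 / 2 :=
    ContinuousAt.eventually_lt (by fun_prop) continuousAt_const (by simp)
  filter_upwards [e1, e2, e3, e4] with z h1 h2 h3 h4 hz hz0
  refine ⟨hsub h2, ?_⟩
  have t := (abs_le.1 (hT _ h1 _ h2).2).1
  simp only [add_sub_cancel_left, map_smul, smul_eq_mul, norm_smul, Real.norm_eq_abs,
    mul_pow, sq_abs] at t
  have g1 : fderiv ℝ F.S z.2 (F.gradient z.2) = F.gradNorm z.2 ^ 2 := (gradNorm_sq hz).symm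
  rw [g1] at t
  have g2 := (norm_gradient_sq_le hz).trans (mul_le_mul_of_nonneg_right h3.le (sq_nonneg _))
  have g3 := mul_le_mul_of_nonneg_left g2 (mul_nonneg hK0 (sq_nonneg z.1))
  have g4 := mul_le_mul_of_nonneg_right h4.le (mul_nonneg hz0.le (sq_nonneg (F.gradNorm z.2)))
  have g5 := hm _ hz
  nlinarith

/-- The information potential has at most one critical point. -/
theorem critical_point_unique (hp : p ∈ F.carrier) (hp0 : fderiv ℝ F.S p = 0)
    (hq : q ∈ F.carrier) (hq0 : fderiv ℝ F.S q = 0) : p = q := by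
  obtain ⟨m, hm⟩ := F.exists_S_add_gradNorm_sq
  by_contra hne
  obtain ⟨γ, hγ⟩ := (F.isOpen_carrier.isConnected_iff_isPathConnected.1
    F.isConnected_carrier).joinedIn p hp q hq
  have hSγ : Continuous fun t => F.S (γ t) :=
    F.S_contDiffOn.continuousOn.comp_continuous γ.continuous hγ
  obtain ⟨t₀, -, ht₀⟩ := isCompact_univ.exists_isMinOn univ_nonempty hSγ.continuousOn
  set c := F.S (γ t₀) with hc
  have hmc : 0 ≤ m - c := by
    have := hm _ (hγ t₀)
    nlinarith [sq_nonneg (F.gradNorm (γ t₀))]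
  -- Compactness of {S ≥ c} makes the admissible step size uniform.
  have hstep := (F.isCompact_superlevel c).eventually_forall_of_forall_eventually
    (x₀ := (0 : ℝ)) (P := fun τ y => y ∈ F.carrier → 0 < τ → y + τ • F.gradient y ∈ F.carrier ∧
      m - F.S (y + τ • F.gradient y) ≤ (1 - τ) * (m - F.S y)) fun y hy => eventually_gradient_step hm hy.1
  obtain ⟨e, he, hev⟩ := Metric.eventually_nhds_iff_ball.1 hstep
  obtain ⟨τ, hτ0, hτ⟩ := exists_between (lt_min he one_pos)
  have hτ1 : τ < 1 := hτ.trans_le (min_le_right _ _)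
  have hτb : τ ∈ Metric.ball (0 : ℝ) e := by
    rw [Metric.mem_ball, dist_zero_right, Real.norm_eq_abs, abs_of_pos hτ0]
    exact hτ.trans_le (min_le_left _ _)
  -- Gradient steps fix the critical end points, while m - S decays geometrically along the whole
  -- path. Since S never falls below c, the same step size remains admissible.
  have hiter : ∀ k : ℕ, ∃ f : unitInterval → (Fin n → ℝ), Continuous f ∧ f 0 = p ∧ f 1 = q ∧
      ∀ t, f t ∈ F.carrier ∧ m - F.S (f t) ≤ (1 - τ) ^ k * (m - c) := by
    intro k
    induction k with
    | zero =>
      refine ⟨γ, γ.continuous, γ.source, γ.target, fun t => ⟨hγ t, ?_⟩⟩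
      have : c ≤ F.S (γ t) := ht₀ (mem_univ t)
      linarith
    | succ k ih =>
      obtain ⟨f, hf, hf0, hf1, hft⟩ := ih
      refine ⟨fun t => f t + τ • F.gradient (f t), hf.add ((show Continuous fun t => F.gradient (f t)
        from continuousOn_gradient.comp_continuous hf fun t => (hft t).1).const_smul τ),
        ?_, ?_, fun t => ?_⟩
      · simp [hf0, gradient, hp0]
      · simp [hf1, gradient, hq0]
      · have hpow : (1 - τ) ^ k ≤ 1 := pow_le_one₀ (by linarith) (by linarith)
        have hct : c ≤ F.S (f t) := by
          have := (hft t).2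
          nlinarith
        obtain ⟨h1, h2⟩ := hev τ hτb (f t) ⟨(hft t).1, hct⟩ (hft t).1 hτ0
        refine ⟨h1, h2.trans ?_⟩
        rw [pow_succ', mul_assoc]
        exact mul_le_mul_of_nonneg_left (hft t).2 (by linarith)
  have hiso := eventually_nhdsWithin_iff.1 (eventually_fderiv_S_ne_zero hp hp0)
  obtain ⟨r₀, hr₀, hr₀'⟩ := Metric.eventually_nhds_iff_ball.1
    (hiso.and (F.isOpen_carrier.mem_nhds hp))
  have hqp : 0 < ‖q - p‖ := norm_pos_iff.2 (sub_ne_zero.2 (Ne.symm hne))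
  obtain ⟨r, hr, hr'⟩ := exists_between (lt_min hr₀ hqp)
  have hsph : ∀ y ∈ Metric.sphere p r, y ∈ F.carrier ∧ F.S y < m := by
    intro y hy
    have hyb : y ∈ Metric.ball p r₀ := by
      rw [Metric.mem_ball, Metric.mem_sphere.1 hy]
      exact hr'.trans_le (min_le_left _ _)
    obtain ⟨h1, h2⟩ := hr₀' y hyb
    have hyp : y ≠ p := by
      rintro rfl
      rw [mem_sphere_iff_norm, sub_self, norm_zero] at hy
      exact hr.ne hy
    have hg : F.gradNorm y ≠ 0 := fun h => h1 hyp ((gradNorm_eq_zero_iff h2).1 h)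
    have := hm y h2
    have := sq_pos_of_ne_zero hg
    exact ⟨h2, by linarith⟩
  -- Each deformed path crosses the sphere, so the maximum of S on the sphere would have to be at
  -- least m.
  have hivt : ∀ k : ℕ, ∃ y ∈ Metric.sphere p r, m - F.S y ≤ (1 - τ) ^ k * (m - c) := by
    intro k
    obtain ⟨f, hf, hf0, hf1, hft⟩ := hiter k
    obtain ⟨t, ht⟩ := mem_range_of_exists_le_of_exists_ge (f := fun t => ‖f t - p‖) (c := r)
      (by fun_prop) ⟨0, by simp [hf0, hr.le]⟩
      ⟨1, by simpa only [hf1] using (hr'.trans_le (min_le_right _ _)).le⟩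
    exact ⟨f t, mem_sphere_iff_norm.2 ht, (hft t).2⟩
  obtain ⟨y₀, hy₀, -⟩ := hivt 0
  obtain ⟨y, hy, hymax⟩ := (isCompact_sphere p r).exists_isMaxOn ⟨y₀, hy₀⟩
    (F.S_contDiffOn.continuousOn.mono fun y hy => (hsph y hy).1)
  have hlim : Tendsto (fun k : ℕ => (1 - τ) ^ k * (m - c)) atTop (𝓝 (0 * (m - c))) :=
    (tendsto_pow_atTop_nhds_zero_of_lt_one (by linarith) (by linarith)).mul_const _
  have hle : m - F.S y ≤ 0 * (m - c) := ge_of_tendsto' hlim fun k => by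
    obtain ⟨y', hy', hk⟩ := hivt k
    have : F.S y' ≤ F.S y := hymax hy'
    linarith
  have := (hsph y hy).2
  linarith

end FluctuationGeometry

/-! ### Global solutions of a cut-off vector field -/

section Cutoff

open scoped Manifold ContDiff

/-- A vector field, cut off outside a neighbourhood of a compact set, has solutions at all times. -/
theorem exists_solution_cutoff {Z : Type*} [NormedAddCommGroup Z] [NormedSpace ℝ Z]
    [FiniteDimensional ℝ Z] {V : Z → Z} {Ω K : Set Z} (hΩ : IsOpen Ω) (hV : ContDiffOn ℝ 1 V Ω)
    (hK : IsCompact K) (hKΩ : K ⊆ Ω) (z₀ : Z) {T : ℝ} (hT : 0 ≤ T) :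
    ∃ W, IsOpen W ∧ K ⊆ W ∧ W ⊆ Ω ∧ ∃ z : ℝ → Z, z 0 = z₀ ∧ ContinuousOn z (Icc 0 T) ∧
      ∀ t ∈ Icc 0 T, z t ∈ W → HasDerivWithinAt z (V (z t)) (Icc 0 T) t := by
  have : CompleteSpace Z := FiniteDimensional.complete ℝ Z
  have : ProperSpace Z := FiniteDimensional.proper ℝ Z
  obtain ⟨K', hK', hKK', hK'Ω⟩ := exists_compact_between hK hΩ hKΩ
  obtain ⟨χ, hχ1, hχ0, -⟩ :=
    exists_contMDiffMap_one_nhds_of_subset_interior (n := 1) 𝓘(ℝ, Z) hK.isClosed hKK'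
  obtain ⟨W, hW, hKW, hWχ⟩ := eventually_nhdsSet_iff_exists.1 hχ1
  have hχ : ContDiff ℝ 1 χ := χ.contMDiff.contDiff
  set f : Z → Z := fun z => χ z • V z with hf
  have hf0 : ∀ z ∉ K', f z = 0 := fun z hz => by simp [hf, hχ0 z hz]
  have hfc : ContDiff ℝ 1 f := by
    refine contDiff_iff_contDiffAt.2 fun z => ?_
    by_cases hz : z ∈ Ω
    · exact hχ.contDiffAt.smul (hV.contDiffAt (hΩ.mem_nhds hz))
    · have hz' : K'ᶜ ∈ 𝓝 z := hK'.isClosed.isOpen_compl.mem_nhds fun h => hz (hK'Ω h)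
      exact (contDiffAt_const (c := (0 : Z))).congr_of_eventuallyEq
        (by filter_upwards [hz'] with y hy using hf0 y hy)
  have hcs : HasCompactSupport f := HasCompactSupport.intro hK' hf0
  obtain ⟨Lip, hLip⟩ := hfc.lipschitzWith_of_hasCompactSupport hcs one_ne_zero
  obtain ⟨B, hB⟩ := hcs.exists_bound_of_continuous hfc.continuous
  have hB0 : 0 ≤ B := (norm_nonneg _).trans (hB z₀)
  -- The cut-off field is globally Lipschitz and bounded by B, so a solution moves at most B T and
  -- one application of Picard–Lindelöf covers [0, T].
  have hPL : IsPicardLindelof (fun _ => f) (tmin := 0) (tmax := T) ⟨0, left_mem_Icc.2 hT⟩ z₀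
      ⟨B * T, mul_nonneg hB0 hT⟩ 0 ⟨B, hB0⟩ Lip :=
    IsPicardLindelof.of_time_independent (fun x _ => hB x) hLip.lipschitzOnWith (by
        simp only [sub_zero, sub_self, max_eq_left hT, NNReal.coe_zero]
        exact le_rfl)
  obtain ⟨z, hz0, hz⟩ := hPL.exists_eq_forall_mem_Icc_hasDerivWithinAt₀
  refine ⟨W, hW, hKW, fun y hy => ?_, z, hz0, fun t ht => (hz t ht).continuousWithinAt,
    fun t ht hzt => ?_⟩
  · by_contra hcon
    have h1 := hχ0 y fun h => hcon (hK'Ω h)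
    rw [hWχ y hy] at h1
    exact one_ne_zero h1
  · have h := hz t ht
    simp only [hf, hWχ _ hzt, one_smul] at h
    exact h

end Cutoff

/-! ### ψ as a 1-Lipschitz function, and the geodesic along the gradient -/

namespace FluctuationGeometry

open StatisticalManifold

variable {n : ℕ} {F : FluctuationGeometry n} {x p : Fin n → ℝ} {m : ℝ}

/-- `ψ` changes along a curve by at most the length of the curve. -/
theorem abs_gradNorm_sub_le_length (hm : ∀ x ∈ F.carrier, F.S x + F.gradNorm x ^ 2 / 2 = m)
    {γ : ℝ → Fin n → ℝ} {a b : ℝ} (hγ : F.IsCurve γ a b) :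
    |F.gradNorm (γ b) - F.gradNorm (γ a)| ≤ F.length γ a b := by
  rcases hγ.le.eq_or_lt with rfl | hab
  · simp [length_nonneg le_rfl]
  obtain ⟨s, hs, hs0, hd, hsp, hl⟩ := hγ.exists_continuous_speed hab
  have hψ : ∀ y ∈ F.carrier, 2 * (m - F.S y) = F.gradNorm y ^ 2 := fun y hy => by
    have := hm y hy
    linarith
  -- The root √(2(m - S)) need not be differentiable where S = m, hence the δ² under it. The sign e
  -- covers both directions of the absolute value.
  have key : ∀ e : ℝ, |e| = 1 → ∀ δ > 0, e * Real.sqrt (2 * (m - F.S (γ b)) + δ ^ 2) -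
      e * Real.sqrt (2 * (m - F.S (γ a)) + δ ^ 2) ≤ F.length γ a b := by
    intro e he δ hδ
    rw [hl]
    have hpos : ∀ y ∈ F.carrier, 0 < 2 * (m - F.S y) + δ ^ 2 := fun y hy => by
      rw [hψ y hy]
      positivity
    refine intervalIntegral.sub_le_integral_of_hasDeriv_right_of_le
      (g := fun r => e * Real.sqrt (2 * (m - F.S (γ r)) + δ ^ 2))
      (g' := fun r => e * (2 * -(fderiv ℝ F.S (γ r) (deriv γ r)) /
        (2 * Real.sqrt (2 * (m - F.S (γ r)) + δ ^ 2)))) hab.le ?_ ?_ hs.integrableOn_Icc ?_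
    · have : ContinuousOn (fun r => F.S (γ r)) (Icc a b) :=
        F.S_contDiffOn.continuousOn.comp hγ.contDiffOn.continuousOn hγ.mapsTo
      exact continuousOn_const.mul
        ((continuousOn_const.mul (continuousOn_const.sub this)).add continuousOn_const).sqrt
    · intro r hr
      have hy := hγ.mapsTo (Ioo_subset_Icc_self hr)
      have h1 : HasDerivAt (fun r => F.S (γ r)) (fderiv ℝ F.S (γ r) (deriv γ r)) r :=
        (differentiableAt_S hy).hasFDerivAt.comp_hasDerivAt r (hd r hr)
      exact (((((h1.const_sub m).const_mul 2).add_const (δ ^ 2)).sqrt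
        (hpos _ hy).ne').const_mul e).hasDerivWithinAt
    · intro r hr
      have hy := hγ.mapsTo (Ioo_subset_Icc_self hr)
      set w := Real.sqrt (2 * (m - F.S (γ r)) + δ ^ 2) with hw
      have hw0 : 0 < w := Real.sqrt_pos.2 (hpos _ hy)
      have hw2 : w ^ 2 = F.gradNorm (γ r) ^ 2 + δ ^ 2 := by
        rw [hw, Real.sq_sqrt (hpos _ hy).le, hψ _ hy]
      have h1 := hsp r hr (fderiv ℝ F.S (γ r))
      rw [← gradNorm_sq hy] at h1
      have h2 : |fderiv ℝ F.S (γ r) (deriv γ r)| ≤ w * s r := by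
        refine abs_le_of_sq_le_sq (h1.trans ?_) (mul_nonneg hw0.le (hs0 r))
        rw [mul_pow, hw2]
        exact mul_le_mul_of_nonneg_right (by linarith [sq_nonneg δ]) (sq_nonneg _)
      refine (le_abs_self _).trans ?_
      rw [abs_mul, he, one_mul, abs_div, abs_mul, abs_neg, abs_of_pos (by positivity : 0 < 2 * w),
        abs_of_pos (two_pos : (0 : ℝ) < 2), div_le_iff₀ (by positivity)]
      linarith
  have lim : ∀ e : ℝ, |e| = 1 →
      e * F.gradNorm (γ b) - e * F.gradNorm (γ a) ≤ F.length γ a b := by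
    intro e he
    have ha := hγ.mapsTo (left_mem_Icc.2 hab.le)
    have hb := hγ.mapsTo (right_mem_Icc.2 hab.le)
    have hlim : Tendsto (fun δ : ℝ => e * Real.sqrt (2 * (m - F.S (γ b)) + δ ^ 2) -
        e * Real.sqrt (2 * (m - F.S (γ a)) + δ ^ 2)) (𝓝[>] 0)
        (𝓝 (e * Real.sqrt (2 * (m - F.S (γ b)) + 0 ^ 2) -
          e * Real.sqrt (2 * (m - F.S (γ a)) + 0 ^ 2))) :=
      (Continuous.tendsto (by fun_prop) 0).mono_left nhdsWithin_le_nhds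
    have := le_of_tendsto hlim (eventually_nhdsWithin_of_forall (key e he))
    rwa [zero_pow two_ne_zero, add_zero, add_zero, hψ _ ha, hψ _ hb,
      Real.sqrt_sq gradNorm_nonneg, Real.sqrt_sq gradNorm_nonneg] at this
  refine abs_le.2 ⟨?_, ?_⟩
  · have := lim (-1) (by simp)
    linarith
  · have := lim 1 (by simp)
    linarith

/-- Unit covectors are bounded over compact sets. -/
theorem exists_norm_le_of_unit {X : StatisticalManifold n} {K : Set (Fin n → ℝ)}
    (hK : IsCompact K) (hKX : K ⊆ X.carrier) :
    ∃ R, ∀ y ∈ K, ∀ p : (Fin n → ℝ) →L[ℝ] ℝ, p (X.cometric y p) = 1 → ‖p‖ ≤ R := by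
  obtain ⟨C, hC⟩ := (hK.prod (isCompact_closedBall (0 : Fin n → ℝ) 1)).exists_bound_of_continuousOn
    (continuousOn_normSq.mono (prod_mono hKX (subset_univ _)))
  refine ⟨Real.sqrt C, fun y hy p hp => ?_⟩
  refine ContinuousLinearMap.opNorm_le_of_unit_norm (Real.sqrt_nonneg _) fun v hv => ?_
  have h1 := apply_sq_le (hKX hy) p v
  rw [hp, one_mul] at h1
  have h2 := hC (y, v) ⟨hy, by simp [hv]⟩
  rw [Real.norm_eq_abs]
  exact Real.abs_le_sqrt (h1.trans ((le_abs_self _).trans h2))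

/-- The geodesic from `x` in the direction of the gradient reaches the maximum of `S` after the
time `ψ(x)`. -/
theorem exists_geodesic_to_max (hm : ∀ x ∈ F.carrier, F.S x + F.gradNorm x ^ 2 / 2 = m)
    (hx : x ∈ F.carrier) (hL : 0 < F.gradNorm x) :
    ∃ γ γ' : ℝ → Fin n → ℝ, γ 0 = x ∧ F.S (γ (F.gradNorm x)) = m ∧
      ContinuousOn γ' (Icc 0 (F.gradNorm x)) ∧ ∀ t ∈ Icc 0 (F.gradNorm x),
        HasDerivWithinAt γ (γ' t) (Icc 0 (F.gradNorm x)) t ∧ γ t ∈ F.carrier ∧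
        F.normSq (γ t) (γ' t) = 1 := by
  set L := F.gradNorm x with hLdef
  set σ := fderiv ℝ F.S x with hσ
  have hL2 : σ (F.cometric x σ) = L ^ 2 := (gradNorm_sq hx).symm
  set K := {y ∈ F.carrier | F.S x ≤ F.S y} with hKdef
  have hK : IsCompact K := F.isCompact_superlevel _
  obtain ⟨R, hR⟩ := exists_norm_le_of_unit (X := F.toStatisticalManifold) hK fun y hy => hy.1
  set K₀ := K ×ˢ Metric.closedBall (0 : (Fin n → ℝ) →L[ℝ] ℝ) R with hK₀def
  have hK₀ : IsCompact K₀ := hK.prod (isCompact_closedBall _ _)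
  obtain ⟨W, hW, hKW, hWΩ, z, hz0, hzc, hz⟩ := exists_solution_cutoff
    (F.isOpen_carrier.prod isOpen_univ) (contDiffOn_hamiltonField F.isOpen_carrier
      F.contDiffOn_cometric) hK₀ (fun y hy => ⟨hy.1.1, mem_univ _⟩) (x, L⁻¹ • σ) hL.le
  set en : (Fin n → ℝ) × ((Fin n → ℝ) →L[ℝ] ℝ) → ℝ := fun y => y.2 (F.cometric y.1 y.2) with hen
  set Φ : (Fin n → ℝ) × ((Fin n → ℝ) →L[ℝ] ℝ) → ℝ :=
    fun y => fderiv ℝ F.S y.1 (F.cometric y.1 y.2) with hΦ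
  have hfst : ContinuousOn (fun y : (Fin n → ℝ) × ((Fin n → ℝ) →L[ℝ] ℝ) => F.cometric y.1 y.2)
      (F.carrier ×ˢ univ) :=
    (F.contDiffOn_cometric.continuousOn.comp continuousOn_fst fun y hy => hy.1).clm_apply
      continuousOn_snd
  have henc : ContinuousOn en (F.carrier ×ˢ univ) := continuousOn_snd.clm_apply hfst
  have hΦc : ContinuousOn Φ (F.carrier ×ˢ univ) :=
    (contDiffOn_fderiv_S.continuousOn.comp continuousOn_fst fun y hy => hy.1).clm_apply hfst
  have hSc : ContinuousOn (fun y : (Fin n → ℝ) × ((Fin n → ℝ) →L[ℝ] ℝ) => F.S y.1)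
      (F.carrier ×ˢ univ) :=
    F.S_contDiffOn.continuousOn.comp continuousOn_fst fun y hy => hy.1
  -- Continuous induction on [0, L]: A collects the times at which the solution is still in K₀ and
  -- unit energy, Φ = L - t and S = S(x) + L t - t²/2 hold.
  set A : Set ℝ := {t | z t ∈ K₀ ∧ en (z t) = 1 ∧ Φ (z t) + t = L ∧
    F.S (z t).1 - (L * t - t ^ 2 / 2) = F.S x} with hA
  have hclosed : IsClosed (A ∩ Icc 0 L) := by
    -- The cut-off solution may leave the manifold, where the functions need not be continuous;
    -- closedness is therefore checked on the part of the interval with values in K₀.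
    set T := Icc 0 L ∩ z ⁻¹' K₀ with hTdef
    have hT : IsClosed T := hzc.preimage_isClosed_of_isClosed isClosed_Icc hK₀.isClosed
    have hzT : ContinuousOn z T := hzc.mono inter_subset_left
    have hmaps : MapsTo z T (F.carrier ×ˢ univ) := fun t ht => ⟨ht.2.1.1, mem_univ _⟩
    have hcont : ContinuousOn (fun t => (en (z t), Φ (z t) + t,
        F.S (z t).1 - (L * t - t ^ 2 / 2))) T :=
      (henc.comp hzT hmaps).prodMk (((hΦc.comp hzT hmaps).add continuousOn_id).prodMk
        ((hSc.comp hzT hmaps).sub (by fun_prop)))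
    convert hcont.preimage_isClosed_of_isClosed hT (isClosed_singleton (x := (1, L, F.S x))) using 1
    ext t
    simp only [hA, hTdef, mem_inter_iff, mem_ofPred_eq, mem_preimage, mem_singleton_iff,
      Prod.mk.injEq]
    tauto
  have h0A : (0 : ℝ) ∈ A := by
    have e1 : en (z 0) = 1 := by
      simp only [hen, hz0, map_smul, smul_apply, smul_eq_mul, hL2]
      field_simp
    have e2 : Φ (z 0) = L := by
      simp only [hΦ, hz0, map_smul, smul_eq_mul, ← hσ, hL2]
      field_simp
    have hxK : x ∈ K := ⟨hx, le_rfl⟩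
    refine ⟨⟨by rw [hz0]; exact hxK, ?_⟩, e1, by rw [e2, add_zero], by simp [hz0]⟩
    have := hR x hxK (L⁻¹ • σ) (by simpa [hen, hz0] using e1)
    simpa [hz0] using this
  have hsub : Icc 0 L ⊆ A := by
    refine hclosed.Icc_subset_of_forall_exists_gt h0A fun t ht y hy => ?_
    obtain ⟨⟨htK, hten, htΦ, htS⟩, ht0, htL⟩ := ht
    have hnhds : ∀ᶠ r in 𝓝[Icc 0 L] t, z r ∈ W :=
      (hzc t ⟨ht0, htL.le⟩).eventually_mem (hW.mem_nhds (hKW htK))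
    obtain ⟨e, he, hball⟩ := Metric.mem_nhdsWithin_iff.1 hnhds
    obtain ⟨t', htt', ht'⟩ := exists_between (lt_min (lt_min (mem_Ioi.1 hy) htL)
      (by linarith : t < t + e))
    have ht'y : t' < y := ht'.trans_le ((min_le_left _ _).trans (min_le_left _ _))
    have ht'L : t' < L := ht'.trans_le ((min_le_left _ _).trans (min_le_right _ _))
    have ht'e : t' < t + e := ht'.trans_le (min_le_right _ _)
    have hrI : ∀ r ∈ Icc t t', r ∈ Icc 0 L := fun r hr => ⟨ht0.trans hr.1, hr.2.trans ht'L.le⟩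
    have hrW : ∀ r ∈ Icc t t', z r ∈ W := fun r hr => hball ⟨by
      rw [Metric.mem_ball, Real.dist_eq, abs_of_nonneg (by linarith [hr.1])]
      linarith [hr.2], hrI r hr⟩
    have hrC : ∀ r ∈ Icc t t', (z r).1 ∈ F.carrier := fun r hr => (hWΩ (hrW r hr)).1
    have hzc' : ContinuousOn z (Icc t t') := hzc.mono hrI
    have hmaps : MapsTo z (Icc t t') (F.carrier ×ˢ univ) := fun r hr => ⟨hrC r hr, mem_univ _⟩
    have hode : ∀ r ∈ Ico t t', HasDerivWithinAt z (hamiltonField F.cometric (z r)) (Ici r) r := by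
      intro r hr
      have hr' := Ico_subset_Icc_self hr
      exact (hz r (hrI r hr') (hrW r hr')).mono_of_mem_nhdsWithin
        (Icc_mem_nhdsGE_of_mem ⟨(hrI r hr').1, hr.2.trans ht'L⟩)
    have hE : ∀ r ∈ Icc t t', en (z r) = 1 := by
      intro r hr
      rw [← hten]
      refine constant_of_has_deriv_right_zero (f := fun r => en (z r)) (henc.comp hzc' hmaps)
        (fun r hr => ?_) r hr
      have hc := hrC r (Ico_subset_Icc_self hr)
      exact hasDerivWithinAt_hamilton_energy (differentiableAt_cometric hc) (cometric_symm hc)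
        (hode r hr)
    have hP : ∀ r ∈ Icc t t', Φ (z r) + r = L := by
      intro r hr
      rw [← htΦ]
      refine constant_of_has_deriv_right_zero (f := fun r => Φ (z r) + r)
        ((hΦc.comp hzc' hmaps).add continuousOn_id) (fun r hr => ?_) r hr
      have hr' := Ico_subset_Icc_self hr
      have hc := hrC r hr'
      have h1 := hasDerivWithinAt_fderiv_hamilton (differentiableAt_cometric hc) (cometric_symm hc)
        (differentiableAt_fderiv_S hc) (hode r hr)
      rw [geodesicHessian_eq hc, show (z r).2 (F.cometric (z r).1 (z r).2) = 1 from hE r hr'] at h1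
      exact (h1.fun_add (hasDerivAt_id r).hasDerivWithinAt).congr_deriv (by norm_num)
    have hS : ∀ r ∈ Icc t t', F.S (z r).1 - (L * r - r ^ 2 / 2) = F.S x := by
      intro r hr
      rw [← htS]
      refine constant_of_has_deriv_right_zero (f := fun r => F.S (z r).1 - (L * r - r ^ 2 / 2))
        ((hSc.comp hzc' hmaps).sub (by fun_prop)) (fun r hr => ?_) r hr
      have hr' := Ico_subset_Icc_self hr
      have hc := hrC r hr'
      have h1 : HasDerivWithinAt (fun r => (z r).1) (F.cometric (z r).1 (z r).2) (Ici r) r :=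
        ((hasFDerivAt_fst (𝕜 := ℝ) (p := z r)).comp_hasDerivWithinAt r (hode r hr) :)
      have h2 := HasFDerivAt.comp_hasDerivWithinAt (f := fun r => (z r).1) r
        (differentiableAt_S hc).hasFDerivAt h1
      have h3 : HasDerivAt (fun r : ℝ => L * r - r ^ 2 / 2) (L - r) r :=
        (((hasDerivAt_id r).const_mul L).fun_sub (((hasDerivAt_id r).fun_pow 2).div_const 2)
          ).congr_deriv (by simp)
      refine (h2.fun_sub h3.hasDerivWithinAt).congr_deriv ?_
      have := hP r hr'
      simp only [hΦ] at this
      linarith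
    have hmem : t' ∈ Icc t t' := right_mem_Icc.2 htt'.le
    -- L t - t²/2 ≥ 0 for 0 ≤ t ≤ L, so the geodesic cannot leave the superlevel set.
    have hKt : (z t').1 ∈ K := ⟨hrC t' hmem, by
      have := hS t' hmem
      nlinarith [(hrI t' hmem).1, (hrI t' hmem).2]⟩
    refine ⟨t', ⟨⟨hKt, ?_⟩, hE t' hmem, hP t' hmem, hS t' hmem⟩, htt', ht'y.le⟩
    simpa using hR _ hKt _ (hE t' hmem)
  refine ⟨fun t => (z t).1, fun t => F.cometric (z t).1 (z t).2, by simp [hz0], ?_,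
    hfst.comp hzc fun t ht => ⟨(hsub ht).1.1.1, mem_univ _⟩, fun t ht => ⟨?_, (hsub ht).1.1.1, ?_⟩⟩
  · have h1 := (hsub (right_mem_Icc.2 hL.le)).2.2.2
    have h2 := hm x hx
    simp only
    linarith
  · exact ((hasFDerivAt_fst (𝕜 := ℝ) (p := z t)).comp_hasDerivWithinAt t
      (hz t ht (hKW (hsub ht).1)) :)
  · rw [normSq_cometric (hsub ht).1.1.1]
    exact (hsub ht).2.1

end FluctuationGeometry

/-! ### The gaussian potential, distances and level sets -/

namespace FluctuationGeometry

open StatisticalManifold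

variable {n : ℕ} {F : FluctuationGeometry n} {x p : Fin n → ℝ} {m : ℝ}

/-- The gaussian weight is exp(-m) times the probability weight, whose total mass is 1. -/
theorem gaussianPotential_eq (hm : ∀ x ∈ F.carrier, F.S x + F.gradNorm x ^ 2 / 2 = m) :
    F.gaussianPotential = m := by
  have hac : F.invVolume ≪ volume.restrict F.carrier := withDensity_absolutelyContinuous _ _
  have hmem : ∀ᵐ x ∂F.invVolume, x ∈ F.carrier :=
    hac.ae_le (ae_restrict_mem F.isOpen_carrier.measurableSet)
  have hmeas : AEStronglyMeasurable (fun x => Real.exp (F.S x)) F.invVolume :=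
    ((Real.continuous_exp.comp_continuousOn F.S_contDiffOn.continuousOn).aestronglyMeasurable
      F.isOpen_carrier.measurableSet).mono_ac hac
  have hone : ∫ x, Real.exp (F.S x) ∂F.invVolume = 1 := by
    rw [integral_eq_lintegral_of_nonneg_ae (Eventually.of_forall fun x => (Real.exp_pos _).le) hmeas]
    have h := F.isProbabilityMeasure.measure_univ
    rw [withDensity_apply _ MeasurableSet.univ, Measure.restrict_univ] at h
    rw [h, ENNReal.toReal_one]
  have hZ : F.partitionFunction = Real.exp (-m) := by
    have : F.partitionFunction = ∫ x, Real.exp (-m) * Real.exp (F.S x) ∂F.invVolume := by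
      refine integral_congr_ae ?_
      filter_upwards [hmem] with x hx
      rw [← Real.exp_add, ← hm x hx]
      congr 1
      ring
    rw [this, integral_const_mul, hone, mul_one]
  rw [gaussianPotential, hZ, Real.log_exp, neg_neg]

/-- Minimal geodesics between an arbitrary point and the maximum of `S`. -/
theorem exists_minimal_geodesic (hm : ∀ x ∈ F.carrier, F.S x + F.gradNorm x ^ 2 / 2 = m)
    (hp : p ∈ F.carrier) (hp0 : fderiv ℝ F.S p = 0) (hx : x ∈ F.carrier) :
    (∃ (γ : ℝ → Fin n → ℝ) (a b : ℝ), F.IsCurve γ a b ∧ γ a = x ∧ γ b = p ∧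
      F.length γ a b = F.gradNorm x) ∧
    ∃ (γ : ℝ → Fin n → ℝ) (a b : ℝ), F.IsGeodesic γ a b ∧ γ a = p ∧ γ b = x ∧
      F.length γ a b = F.gradNorm x := by
  have hψp : F.gradNorm p = 0 := (gradNorm_eq_zero_iff hp).2 hp0
  have hmin : ∀ (η : ℝ → Fin n → ℝ) (c d : ℝ), F.IsCurve η c d → η c = p → η d = x →
      F.gradNorm x ≤ F.length η c d := by
    intro η c d hη hc hd
    have := (le_abs_self _).trans (abs_gradNorm_sub_le_length hm hη)
    rwa [hc, hd, hψp, sub_zero] at this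
  rcases (gradNorm_nonneg (F := F) (x := x)).eq_or_lt with h0 | hL
  · have hxp : x = p :=
      critical_point_unique hx ((gradNorm_eq_zero_iff hx).1 h0.symm) hp hp0
    subst hxp
    have hcurve : F.IsCurve (fun _ => x) 0 0 := ⟨le_rfl, contDiffOn_const, fun _ _ => hx⟩
    have hlen : F.length (fun _ => x) 0 0 = F.gradNorm x := by
      rw [← h0, length, intervalIntegral.integral_same]
    refine ⟨⟨_, 0, 0, hcurve, rfl, rfl, hlen⟩, _, 0, 0, ⟨hcurve, fun η c d hη hc hd => ?_⟩,
      rfl, rfl, hlen⟩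
    rw [hlen]
    exact hmin η c d hη hc hd
  · obtain ⟨γ, γ', hγ0, hγL, hγ', hγ⟩ := exists_geodesic_to_max hm hx hL
    set L := F.gradNorm x with hLdef
    -- S = m forces ψ = 0, so the end point is critical.
    have hend : γ L = p := by
      have hc := (hγ L (right_mem_Icc.2 hL.le)).2.1
      refine critical_point_unique hc ((gradNorm_eq_zero_iff hc).1 ?_) hp hp0
      have := hm _ hc
      rw [hγL] at this
      exact pow_eq_zero_iff two_ne_zero |>.1 (by linarith)
    have hd : ∀ t ∈ Icc 0 L, HasDerivWithinAt γ (γ' t) (Icc 0 L) t := fun t ht => (hγ t ht).1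
    have hrev : MapsTo (fun t => L - t) (Icc 0 L) (Icc 0 L) := fun t ht =>
      ⟨by linarith [ht.2], by linarith [ht.1]⟩
    have hd' : ∀ t ∈ Icc 0 L, HasDerivWithinAt (fun t => γ (L - t)) (-γ' (L - t)) (Icc 0 L) t := by
      intro t ht
      have := (hd _ (hrev ht)).scomp (h := fun t => L - t) t
        (((hasDerivAt_id t).const_sub L).hasDerivWithinAt) hrev
      exact this.congr_deriv (by simp)
    have hlen : F.length γ 0 L = L := by
      rw [length_of_hasDerivWithinAt hd (fun t ht => (hγ t ht).2.2) hL le_rfl le_rfl, sub_zero]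
    have hlen' : F.length (fun t => γ (L - t)) 0 L = L := by
      rw [length_of_hasDerivWithinAt hd' (fun t ht => ?_) hL le_rfl le_rfl, sub_zero]
      have := (hγ _ (hrev ht)).2.2
      rw [normSq] at this ⊢
      rwa [Matrix.mulVec_neg, neg_dotProduct_neg]
    refine ⟨⟨γ, 0, L, isCurve_of_hasDerivWithinAt hL hd hγ' fun t ht => (hγ t ht).2.1, hγ0, hend,
      hlen⟩, fun t => γ (L - t), 0, L, ⟨isCurve_of_hasDerivWithinAt hL hd' ?_
        fun t ht => (hγ _ (hrev ht)).2.1, fun η c d hη hc hd => ?_⟩, by simp [hend], by simp [hγ0],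
      hlen'⟩
    · exact (hγ'.comp (by fun_prop) hrev).neg
    · rw [hlen']
      exact hmin η c d hη (by simpa [hend] using hc) (by simpa [hγ0] using hd)

/-- The gradient geodesic attains the length ψ(x); no curve is shorter, since ψ vanishes at p and
varies by at most the length. -/
theorem dist_eq_gradNorm (hm : ∀ x ∈ F.carrier, F.S x + F.gradNorm x ^ 2 / 2 = m)
    (hp : p ∈ F.carrier) (hp0 : fderiv ℝ F.S p = 0) (hx : x ∈ F.carrier) :
    F.dist x p = F.gradNorm x := by
  refine IsLeast.csInf_eq ⟨(exists_minimal_geodesic hm hp hp0 hx).1, ?_⟩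
  rintro l ⟨γ, a, b, hγ, ha, hb, rfl⟩
  have := (neg_le_abs _).trans (abs_gradNorm_sub_le_length hm hγ)
  rwa [ha, hb, (gradNorm_eq_zero_iff hp).2 hp0, zero_sub, neg_neg] at this

/-- Points with S > c are interior by continuity. An interior point with S = c would be a local
minimum, hence critical with c = m; nearby points would then have S ≥ m, hence ψ = 0, against the
isolation of critical points. -/
theorem frontier_superlevel (hn : 1 ≤ n)
    (hm : ∀ x ∈ F.carrier, F.S x + F.gradNorm x ^ 2 / 2 = m) (c : ℝ) :
    frontier {x ∈ F.carrier | c ≤ F.S x} = F.levelSet c := by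
  have : Nonempty (Fin n) := ⟨⟨0, hn⟩⟩
  rw [(F.isCompact_superlevel c).isClosed.frontier_eq]
  ext x
  constructor
  · rintro ⟨⟨hx, hcx⟩, hint⟩
    refine ⟨hx, le_antisymm (not_lt.1 fun hlt => hint ?_) hcx⟩
    have hS := (differentiableAt_S hx).continuousAt.eventually (lt_mem_nhds hlt)
    refine mem_interior_iff_mem_nhds.2 ?_
    filter_upwards [F.isOpen_carrier.mem_nhds hx, hS] with y hy hy' using ⟨hy, hy'.le⟩
  · rintro ⟨hx, rfl⟩
    refine ⟨⟨hx, le_rfl⟩, fun hint => ?_⟩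
    have hev := mem_interior_iff_mem_nhds.1 hint
    have hloc : IsLocalMin F.S x := by
      filter_upwards [hev] with y hy using hy.2
    have h0 := hloc.fderiv_eq_zero
    have hxm : F.S x = m := by
      have := hm x hx
      rw [(gradNorm_eq_zero_iff hx).2 h0] at this
      linarith
    -- Here the dimension must be positive: a single point has no punctured neighbourhood.
    have : (𝓝[≠] x).NeBot := Module.punctured_nhds_neBot ℝ (Fin n → ℝ) x
    obtain ⟨y, hy0, hy⟩ :=
      ((eventually_fderiv_S_ne_zero hx h0).and (mem_nhdsWithin_of_mem_nhds hev)).exists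
    refine hy0 ((gradNorm_eq_zero_iff hy.1).1 (pow_eq_zero_iff two_ne_zero |>.1 ?_))
    have h1 := hm y hy.1
    have h2 := hy.2
    exact le_antisymm (by linarith) (sq_nonneg _)

end FluctuationGeometry

theorem theorem4 {n : ℕ} (hn : 1 ≤ n) (F : FluctuationGeometry n) :
    (∃! p : Fin n → ℝ, p ∈ F.carrier ∧ IsMaxOn F.S F.carrier p) ∧
    ∀ p ∈ F.carrier, IsMaxOn F.S F.carrier p →
      (∀ c : ℝ, (F.levelSet c).Nonempty → ∃ r : ℝ, 0 ≤ r ∧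
        F.levelSet c = F.geodesicSphere p r ∧
        F.levelSet c = frontier (F.geodesicBall p r) ∧
        c = F.gaussianPotential - r ^ 2 / 2) ∧
      (∀ x ∈ F.carrier,
        F.S x = F.gaussianPotential - F.dist x p ^ 2 / 2 ∧
        F.S x = F.gaussianPotential - F.gradNorm x ^ 2 / 2 ∧
        F.gradNorm x = F.dist x p ∧
        ∃ (γ : ℝ → Fin n → ℝ) (a b : ℝ), F.IsGeodesic γ a b ∧ γ a = p ∧ γ b = x ∧
          F.length γ a b = F.dist x p) := by
  obtain ⟨m, hm⟩ := F.exists_S_add_gradNorm_sq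
  have hP := FluctuationGeometry.gaussianPotential_eq hm
  refine ⟨?_, fun p hp hmax => ?_⟩
  · obtain ⟨p, hp, hmax⟩ := F.exists_isMaxOn
    exact ⟨p, ⟨hp, hmax⟩, fun q hq => FluctuationGeometry.critical_point_unique hq.1
      (FluctuationGeometry.fderiv_S_eq_zero hq.1 hq.2) hp
      (FluctuationGeometry.fderiv_S_eq_zero hp hmax)⟩
  have hp0 := FluctuationGeometry.fderiv_S_eq_zero hp hmax
  have hdist : ∀ x ∈ F.carrier, F.dist x p = F.gradNorm x := fun x hx =>
    FluctuationGeometry.dist_eq_gradNorm hm hp hp0 hx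
  constructor
  · rintro c ⟨x, hx, rfl⟩
    have hx' := hm x hx
    have hψ0 := FluctuationGeometry.gradNorm_nonneg (F := F) (x := x)
    refine ⟨F.gradNorm x, hψ0, ?_, ?_, by rw [hP]; linarith⟩
    · ext y
      refine and_congr_right fun hy => ?_
      have hy' := hm y hy
      rw [hdist y hy, ← sq_eq_sq₀ FluctuationGeometry.gradNorm_nonneg hψ0]
      constructor <;> intro h <;> linarith
    -- The geodesic ball of radius ψ(x) is the superlevel set {S ≥ S(x)}.
    · rw [← FluctuationGeometry.frontier_superlevel hn hm]
      congr 1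
      ext y
      refine and_congr_right fun hy => ?_
      have hy' := hm y hy
      rw [hdist y hy, ← sq_le_sq₀ FluctuationGeometry.gradNorm_nonneg hψ0]
      constructor <;> intro h <;> linarith
  · intro x hx
    have hx' := hm x hx
    rw [hdist x hx, hP]
    exact ⟨by linarith, by linarith, rfl,
      (FluctuationGeometry.exists_minimal_geodesic hm hp hp0 hx).2⟩
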